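/- Let $n\ge 0$ and let $Q$ be a convex polygon in the plane $\mathbb{R}^2$ (the convex hull of finitely many points, with nonempty interior). Let $p_0,\dots,p_{n+2}$ be $n+3$ distinct points which consist of all the vertices of $Q$ together with at most one point in the relative interior of each edge of $Q$. A triangulation $T$ of the configuration $p=(p_0,\dots,p_{n+2})$ is a set of nondegenerate triangles with vertices among the $p_i$ that cover $Q$ and pairwise intersect in common (possibly empty) faces; not every point $p_i$ has to be used. Let $f_0,\dots,f_{n+2}$ be affinely independent points of a finite-dimensional real normed space $E$ (the vertices of an $(n+2)$-simplex). The secondary polytope of the configuration is $$\Sigma(p)=\operatorname{conv}\Big\{\sum_{i=0}^{n+2}\ \sum_{\sigma\in T:\ p_i \text{ is a vertex of } \sigma}\operatorname{vol}(\sigma)\,f_i\ :\ T\text{ is a triangulation of }p\Big\}\subset E ,$$ where $\operatorname{vol}(\sigma)$ is the area of the triangle $\sigma$. Then $\Sigma(p)$ is an $n$-dimensional associahedron: it is an $n$-dimensional convex polytope, and the poset of its nonempty faces, ordered by inclusion, is isomorphic to the poset of all sets of pairwise noncrossing diagonals of a convex $(n+3)$-gon, ordered by reverse inclusion. -/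

import Mathlib

/-! ### Convex polygons in the plane and the point configurations considered -/

/-- The Euclidean plane. -/
abbrev Plane : Type := EuclideanSpace ℝ (Fin 2)

/-- A convex polygon: the convex hull of finitely many points in the plane, with nonempty
interior. -/
def IsConvexPolygon (Q : Set Plane) : Prop :=
  (∃ s : Set Plane, s.Finite ∧ Q = convexHull ℝ s) ∧ (interior Q).Nonempty

/-- The segment from `a` to `b` is an edge (one-dimensional face) of `Q`. Its relative interior is
`openSegment ℝ a b`. -/
def IsPolygonEdge (Q : Set Plane) (a b : Plane) : Prop :=
  a ≠ b ∧ IsExposed ℝ Q (segment ℝ a b)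

/-- The (pairwise distinct) points `p i` are all the vertices of the polygon `Q` together with at
most one point in the relative interior of each edge of `Q`. -/
structure IsVerticesAndEdgePoints {ι : Type*} (Q : Set Plane) (p : ι → Plane) : Prop where
  injective : Function.Injective p
  vertices : Q.extremePoints ℝ ⊆ Set.range p
  vertex_or_edge : ∀ i, p i ∈ Q.extremePoints ℝ ∨
    ∃ a b, IsPolygonEdge Q a b ∧ p i ∈ openSegment ℝ a b
  atMostOne : ∀ a b, IsPolygonEdge Q a b →
    ∀ i j, p i ∈ openSegment ℝ a b → p j ∈ openSegment ℝ a b → i = j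

/-! ### Triangulations and the secondary polytope -/

/-- The convex hull of the points of the configuration `p` with labels in `σ`. -/
def hullOf {ι : Type*} (p : ι → Plane) (σ : Finset ι) : Set Plane :=
  convexHull ℝ (p '' (σ : Set ι))

/-- A triangulation of the planar point configuration `p`, given by the label sets of its
triangles: the triangles are nondegenerate, they cover the convex hull of the configuration, and
any two of them meet in a common (possibly empty) face. Not every point needs to be used. -/
structure IsTriangulation {ι : Type*} [DecidableEq ι] (p : ι → Plane)
    (T : Finset (Finset ι)) : Prop where
  card_eq : ∀ σ ∈ T, σ.card = 3
  affineIndependent : ∀ σ ∈ T, AffineIndependent ℝ (fun i : σ => p i)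
  cover : (⋃ σ ∈ T, hullOf p σ) = convexHull ℝ (Set.range p)
  inter : ∀ σ ∈ T, ∀ τ ∈ T, hullOf p σ ∩ hullOf p τ = hullOf p (σ ∩ τ)

/-- The area of the triangle with label set `σ`. -/
noncomputable def triangleArea {ι : Type*} (p : ι → Plane) (σ : Finset ι) : ℝ :=
  MeasureTheory.volume.real (hullOf p σ)

/-- The GKZ vector `∑ i, ∑ σ ∈ T with i ∈ σ, vol σ • f i` of a triangulation `T`. -/
noncomputable def gkzVector {ι : Type*} [Fintype ι] [DecidableEq ι]
    {E : Type*} [AddCommGroup E] [Module ℝ E]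
    (p : ι → Plane) (f : ι → E) (T : Finset (Finset ι)) : E :=
  ∑ i, ∑ σ ∈ T with i ∈ σ, triangleArea p σ • f i

/-- The secondary polytope of the planar point configuration `p`, formed with respect to the
points `f i` (the vertices of a simplex): the convex hull of the GKZ vectors of all
triangulations. -/
noncomputable def secondaryPolytope {ι : Type*} [Fintype ι] [DecidableEq ι]
    {E : Type*} [AddCommGroup E] [Module ℝ E]
    (p : ι → Plane) (f : ι → E) : Set E :=
  convexHull ℝ {x | ∃ T : Finset (Finset ι), IsTriangulation p T ∧ x = gkzVector p f T}

/-! ### Associahedra -/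

/-- With the vertices of a convex `m`-gon labelled cyclically by `0, …, m - 1`, the pair
`d = (i, j)` with `i < j` is a diagonal: `i` and `j` are not cyclically adjacent. -/
def IsDiagonal {m : ℕ} (d : Fin m × Fin m) : Prop :=
  (d.1 : ℕ) + 1 < d.2 ∧ (d.2 : ℕ) + 1 < d.1 + m

/-- Two diagonals cross in the interior of the polygon: their endpoints alternate. -/
def DiagonalsCross {m : ℕ} (d e : Fin m × Fin m) : Prop :=
  (d.1 < e.1 ∧ e.1 < d.2 ∧ d.2 < e.2) ∨ (e.1 < d.1 ∧ d.1 < e.2 ∧ e.2 < d.2)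

/-- The dissections of a convex `m`-gon (sets of pairwise noncrossing diagonals), ordered by
inclusion; the maximal ones are the triangulations of the `m`-gon. -/
abbrev Dissection (m : ℕ) : Type :=
  {D : Finset (Fin m × Fin m) //
    (∀ d ∈ D, IsDiagonal d) ∧ ∀ d ∈ D, ∀ e ∈ D, ¬ DiagonalsCross d e}

/-- The nonempty faces of a polytope `P` (including `P` itself), ordered by inclusion. -/
abbrev NonemptyFace {E : Type*} [NormedAddCommGroup E] [NormedSpace ℝ E] (P : Set E) : Type _ :=
  {F : Set E // F.Nonempty ∧ IsExposed ℝ P F}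

/-- `P` is an `n`-dimensional associahedron: an `n`-dimensional convex polytope whose nonempty
faces, ordered by inclusion, are isomorphic to the dissections of a convex `(n + 3)`-gon, ordered
by reverse inclusion. -/
structure IsAssociahedron (n : ℕ) {E : Type*} [NormedAddCommGroup E] [NormedSpace ℝ E]
    (P : Set E) : Prop where
  polytope : ∃ s : Set E, s.Finite ∧ P = convexHull ℝ s
  dim_eq : Module.finrank ℝ (vectorSpan ℝ P) = n
  faces : Nonempty (NonemptyFace P ≃o (Dissection (n + 3))ᵒᵈ)

/-! Pairing a weight `w` on the points with the GKZ vector of a triangulation `T` gives three times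
the integral over the polygon of the function that interpolates `w` affinely on each triangle of
`T`. Hence affine weights are constant on all GKZ vectors. For a convex function sampled at the
points, the interpolant lies above the function, so the pairing is bounded below by a number
independent of `T`, with equality exactly when the function is affine on every triangle.

For a diagonal `i j` this is applied to the positive part of an affine function vanishing on the
line `p i p j`. The weight is raised by one at any further point on that line, so that equality
means that no triangle crosses the line and none uses such a point (`diagonalWeight_triangle`). A
diagonal running along an edge past its middle point thus records that this point is unused. This is
why the combinatorics is that of a strictly convex `(n + 3)`-gon even when three points are
collinear.

Sorting the points by angle around an interior point puts them in cyclic position. The nondegenerate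
triangles of a maximal dissection `D` then form a triangulation, and its GKZ vector lies on the
supporting hyperplane of a diagonal `d` if and only if `d ∈ D`
(`IsCyclicPosition.forall_liesOnOneSide_iff`). Comparing `D` with its flips shows that the `n`
diagonal weights of `D` together with three affine weights form a basis of all weights
(`IsCyclicPosition.exists_weight_eq`). So, up to constants, the functionals of the diagonals in `D`
are coordinates on the polytope, which lies in a simplicial cone with apex at the vertex of `D`.

These facts already determine the face lattice (`AssociahedronData`). A functional that is largest
at `D` among the vertices of maximal dissections has nonpositive coefficients in the coordinates of
`D`, by flips. It is therefore maximal on the whole polytope exactly where the coordinates with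
nonzero coefficient attain their bounds. There is no need to show that every triangulation comes
from a dissection. -/

/-! ### Dissections of a polygon and their arcs -/

/-- A set of pairwise noncrossing diagonals of the `m`-gon. -/
def IsDissection {m : ℕ} (D : Finset (Fin m × Fin m)) : Prop :=
  (∀ d ∈ D, IsDiagonal d) ∧ ∀ d ∈ D, ∀ e ∈ D, ¬ DiagonalsCross d e

/-- `(i, j)` is an element of `D` or a side of the `m`-gon. -/
def IsArc {m : ℕ} (D : Finset (Fin m × Fin m)) (i j : Fin m) : Prop :=
  (i : ℕ) < j ∧ ((i, j) ∈ D ∨ (j : ℕ) = i + 1 ∨ ((i : ℕ) = 0 ∧ (j : ℕ) + 1 = m))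

section Combinatorics

variable {m : ℕ} {D : Finset (Fin m × Fin m)}

lemma IsArc.lt {i j : Fin m} (h : IsArc D i j) : (i : ℕ) < j := h.1

lemma isArc_succ {i j : Fin m} (h : (j : ℕ) = i + 1) : IsArc D i j :=
  ⟨by omega, Or.inr (Or.inl h)⟩

lemma IsDissection.isArc (hD : IsDissection D) {d : Fin m × Fin m} (h : d ∈ D) :
    IsArc D d.1 d.2 := by
  have := (hD.1 d h).1
  exact ⟨by omega, Or.inl h⟩

lemma IsArc.mem {i j : Fin m} (h : IsArc D i j) (h1 : (i : ℕ) + 1 < j)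
    (h2 : (j : ℕ) + 1 < i + m) : (i, j) ∈ D := by
  rcases h.2 with h | h | h
  · exact h
  · omega
  · omega

lemma IsDissection.not_cross (hD : IsDissection D) {a b c d : Fin m} (h1 : IsArc D a b)
    (h2 : IsArc D c d) : ¬ ((a : ℕ) < c ∧ (c : ℕ) < b ∧ (b : ℕ) < d) := by
  rintro ⟨h3, h4, h5⟩
  have hb := b.2
  have hd := d.2
  have hab := h1.mem (by omega) (by omega)
  have hcd := h2.mem (by omega) (by omega)
  exact hD.2 _ hab _ hcd (Or.inl ⟨h3, h4, h5⟩)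

/-- A diagonal that crosses no arc belongs to a maximal dissection. -/
lemma isArc_of_maximal (hD : Maximal IsDissection D) {a b : Fin m} (hab : (a : ℕ) < b)
    (h1 : ∀ c d, IsArc D c d → ¬ ((a : ℕ) < c ∧ (c : ℕ) < b ∧ (b : ℕ) < d))
    (h2 : ∀ c d, IsArc D c d → ¬ ((c : ℕ) < a ∧ (a : ℕ) < d ∧ (d : ℕ) < b)) :
    IsArc D a b := by
  by_contra hn
  have hda : IsDiagonal (a, b) := by
    have := b.2
    simp only [IsArc, not_and, not_or] at hn
    obtain ⟨-, h3, h4⟩ := hn hab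
    exact ⟨by simp only; omega, by simp only; omega⟩
  have hgood : IsDissection (insert (a, b) D) := by
    refine ⟨?_, ?_⟩
    · intro d hd
      rcases Finset.mem_insert.1 hd with rfl | hd
      · exact hda
      · exact hD.prop.1 d hd
    · have key : ∀ e ∈ D, ¬ DiagonalsCross (a, b) e ∧ ¬ DiagonalsCross e (a, b) := by
        intro e he
        have := h1 _ _ (hD.prop.isArc he)
        have := h2 _ _ (hD.prop.isArc he)
        simp only [DiagonalsCross, Fin.lt_def]
        omega
      intro d hd e he
      rcases Finset.mem_insert.1 hd with rfl | hd <;> rcases Finset.mem_insert.1 he with rfl | he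
      · simp only [DiagonalsCross, Fin.lt_def]
        omega
      · exact (key e he).1
      · exact (key d hd).2
      · exact hD.prop.2 d hd e he
  have := hD.le_of_ge hgood (Finset.subset_insert _ _) (Finset.mem_insert_self _ _)
  exact hn ⟨hab, Or.inl this⟩

/-- Every long arc of a maximal dissection has an apex below it. -/
lemma exists_apex (hD : Maximal IsDissection D) {i j : Fin m} (h : IsArc D i j)
    (hij : (i : ℕ) + 1 < j) :
    ∃ k : Fin m, (i : ℕ) < k ∧ (k : ℕ) < j ∧ IsArc D i k ∧ IsArc D k j := by
  classical
  have hj := j.2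
  let s : Finset (Fin m) := Finset.univ.filter fun k => IsArc D i k ∧ (k : ℕ) < j
  have hs : s.Nonempty :=
    ⟨⟨i + 1, by omega⟩, by
      simp only [s, Finset.mem_filter, Finset.mem_univ, true_and]
      exact ⟨isArc_succ rfl, hij⟩⟩
  -- The apex is the last vertex before `j` joined to `i`. An arc crossing `(k, j)` would cross `(i,
  -- j)` or `(i, k)`, or would join `i` to a later vertex before `j`.
  obtain ⟨k, hk, hmax⟩ := s.exists_max_image (fun k => (k : ℕ)) hs
  simp only [s, Finset.mem_filter, Finset.mem_univ, true_and] at hk hmax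
  refine ⟨k, hk.1.lt, hk.2, hk.1, isArc_of_maximal hD hk.2 ?_ ?_⟩
  · intro c d hcd h'
    have := hD.prop.not_cross h hcd
    have := hk.1.lt
    omega
  · intro c d hcd h'
    have h1 := hD.prop.not_cross hcd h
    have h2 := hD.prop.not_cross hk.1 hcd
    have h3 := hk.1.lt
    by_cases hc : c = i
    · subst hc
      have := hmax d ⟨hcd, by omega⟩
      omega
    · have : (c : ℕ) ≠ i := fun h => hc (Fin.ext h)
      omega

/-- Every inner vertex is the middle vertex of a triangle of a maximal dissection. -/
lemma exists_base (hD : Maximal IsDissection D) {k : Fin m} (h0 : 0 < (k : ℕ))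
    (h1 : (k : ℕ) + 1 < m) :
    ∃ i j : Fin m, (i : ℕ) < k ∧ (k : ℕ) < j ∧ IsArc D i k ∧ IsArc D k j ∧ IsArc D i j := by
  classical
  let s : Finset (Fin m) := Finset.univ.filter fun j => IsArc D k j
  have hs : s.Nonempty :=
    ⟨⟨k + 1, by omega⟩, by simp [s, isArc_succ (D := D) (i := k) (j := ⟨k + 1, by omega⟩) rfl]⟩
  -- The base joins the farthest neighbours of `k` on either side; an arc crossing it would cross
  -- `(i, k)` or `(k, j)`, or would end at a still farther neighbour of `k`.
  obtain ⟨j, hj, hmax⟩ := s.exists_max_image (fun k => (k : ℕ)) hs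
  let t : Finset (Fin m) := Finset.univ.filter fun i => IsArc D i k
  have ht : t.Nonempty := by
    refine ⟨⟨k - 1, by omega⟩, ?_⟩
    simp only [t, Finset.mem_filter, Finset.mem_univ, true_and]
    exact isArc_succ (by simp only; omega)
  obtain ⟨i, hi, hmin⟩ := t.exists_min_image (fun k => (k : ℕ)) ht
  simp only [s, t, Finset.mem_filter, Finset.mem_univ, true_and] at hi hj hmin hmax
  have hik := hi.lt
  have hkj := hj.lt
  refine ⟨i, j, hik, hkj, hi, hj, isArc_of_maximal hD (by omega) ?_ ?_⟩
  · intro c d hcd h'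
    have h2 := hD.prop.not_cross hi hcd
    have h3 := hD.prop.not_cross hj hcd
    by_cases hc : c = k
    · subst hc
      have := hmax d hcd
      omega
    · have : (c : ℕ) ≠ k := fun h => hc (Fin.ext h)
      omega
  · intro c d hcd h'
    have h2 := hD.prop.not_cross hcd hi
    have h3 := hD.prop.not_cross hcd hj
    by_cases hc : d = k
    · subst hc
      have := hmin c hcd
      omega
    · have : (d : ℕ) ≠ k := fun h => hc (Fin.ext h)
      omega

/-- If `k < l`, the arcs `(i, l)` and `(k, j)` cross. -/
lemma IsDissection.apex_unique (hD : IsDissection D) {i j k l : Fin m}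
    (hik : IsArc D i k) (hkj : IsArc D k j) (hil : IsArc D i l) (hlj : IsArc D l j) : k = l := by
  have h1 := hD.not_cross hil hkj
  have h2 := hD.not_cross hik hlj
  have := hik.lt
  have := hkj.lt
  have := hil.lt
  have := hlj.lt
  apply Fin.ext
  omega

/-- Any difference between the two bases makes two of the six arcs cross. Triangles can therefore be
counted and identified by their middle vertex. -/
lemma IsDissection.base_unique (hD : IsDissection D) {i j i' j' k : Fin m}
    (hik : IsArc D i k) (hkj : IsArc D k j) (hij : IsArc D i j)
    (hik' : IsArc D i' k) (hkj' : IsArc D k j') (hij' : IsArc D i' j') : i = i' ∧ j = j' := by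
  have h1 := hD.not_cross hij hij'
  have h2 := hD.not_cross hij' hij
  have h3 := hD.not_cross hij hkj'
  have h4 := hD.not_cross hij' hkj
  have h5 := hD.not_cross hik hij'
  have h6 := hD.not_cross hik' hij
  have := hik.lt
  have := hkj.lt
  have := hik'.lt
  have := hkj'.lt
  constructor <;> apply Fin.ext <;> omega

end Combinatorics

/-- A maximal dissection of an `(n + 3)`-gon has `n` diagonals. -/
lemma card_of_maximal {n : ℕ} {D : Finset (Fin (n + 3) × Fin (n + 3))}
    (hD : Maximal IsDissection D) : D.card = n := by
  classical
  let r : Fin (n + 3) × Fin (n + 3) := (0, Fin.last _)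
  have hr : r ∉ D := fun h => by
    have := (hD.prop.1 r h).2
    simp [r] at this
  have harc : ∀ d ∈ insert r D, IsArc D d.1 d.2 ∧ (d.1 : ℕ) + 1 < d.2 := by
    intro d hd
    rcases Finset.mem_insert.1 hd with rfl | hd
    · exact ⟨⟨by simp [r], Or.inr (Or.inr (by simp [r]))⟩, by simp [r]⟩
    · exact ⟨hD.prop.isArc hd, (hD.prop.1 d hd).1⟩
  choose! g hg1 hg2 hg3 hg4 using fun d hd => exists_apex hD (harc d hd).1 (harc d hd).2
  -- Sending an arc to the apex below it is a bijection from the diagonals together with the root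
  -- side `r` to the `n + 1` inner vertices.
  have hcard : (insert r D).card = (Finset.Ioo (0 : Fin (n + 3)) (Fin.last _)).card := by
    refine Finset.card_bij (fun d _ => g d) ?_ ?_ ?_
    · intro d hd
      have h1 := hg1 d hd
      have h2 := hg2 d hd
      have := d.2.2
      rw [Finset.mem_Ioo, Fin.lt_def, Fin.lt_def]
      simp only [Fin.val_zero, Fin.val_last]
      omega
    · intro d hd e he hde
      have h1 := hg3 e he
      have h2 := hg4 e he
      have h3 := (harc e he).1
      rw [← hde] at h1 h2
      have := hD.prop.base_unique (hg3 d hd) (hg4 d hd) (harc d hd).1 h1 h2 h3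
      exact Prod.ext this.1 this.2
    · intro k hk
      rw [Finset.mem_Ioo, Fin.lt_def, Fin.lt_def] at hk
      simp only [Fin.val_zero, Fin.val_last] at hk
      obtain ⟨i, j, hik, hkj, h1, h2, h3⟩ := exists_base hD hk.1 (by omega)
      have hmem : (i, j) ∈ insert r D := by
        rcases h3.2 with h | h | h
        · exact Finset.mem_insert_of_mem h
        · omega
        · refine Finset.mem_insert.2 (Or.inl (Prod.ext (Fin.ext h.1) (Fin.ext ?_)))
          simp only [r, Fin.val_last]
          omega
      exact ⟨(i, j), hmem, hD.prop.apex_unique (hg3 _ hmem) (hg4 _ hmem) h1 h2⟩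
  rw [Finset.card_insert_of_notMem hr, Fin.card_Ioo] at hcard
  simp at hcard
  omega

/-! ### Flips, and separation of the triangles of a dissection -/

section Combinatorics

variable {m : ℕ} {D : Finset (Fin m × Fin m)}

/-- Every diagonal of a maximal dissection is a side of a triangle lying above it. -/
lemma exists_outer_apex (hD : Maximal IsDissection D) {i j : Fin m} (h : (i, j) ∈ D) :
    (∃ b, IsArc D j b ∧ IsArc D i b) ∨ ∃ a, IsArc D a i ∧ IsArc D a j := by
  classical
  have hij := hD.prop.isArc h
  have hdiag := hD.prop.1 _ h
  simp only [IsDiagonal] at hij hdiag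
  have hjm := j.2
  let s : Finset (Fin m × Fin m) := Finset.univ.filter fun e =>
    IsArc D e.1 e.2 ∧ (e.1 : ℕ) ≤ i ∧ (j : ℕ) ≤ e.2 ∧ (j : ℕ) - i < e.2 - e.1
  have hs : s.Nonempty := by
    refine ⟨(⟨0, by omega⟩, ⟨m - 1, by omega⟩), ?_⟩
    simp only [s, Finset.mem_filter, Finset.mem_univ, true_and]
    refine ⟨⟨by simp only; omega, Or.inr (Or.inr ⟨rfl, by simp only; omega⟩)⟩, ?_⟩
    omega
  -- Take a shortest arc strictly enclosing `(i, j)`. Its apex is not strictly between `i` and `j`,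
  -- so one of its two lower sides still encloses `(i, j)` and by minimality equals it.
  obtain ⟨⟨a, b⟩, hab, hmin⟩ := s.exists_min_image (fun e => (e.2 : ℕ) - e.1) hs
  simp only [s, Finset.mem_filter, Finset.mem_univ, true_and] at hab hmin
  obtain ⟨hab, hai, hjb, hlt⟩ := hab
  obtain ⟨k, hak, hkb, h1, h2⟩ := exists_apex hD hab (by omega)
  have c1 := hD.prop.not_cross h1 hij
  have c2 := hD.prop.not_cross hij h2
  by_cases hkj : (j : ℕ) ≤ k
  · left
    have := hmin (a, k)
    simp only at this
    by_cases hlt' : (j : ℕ) - i < k - a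
    · have := this ⟨h1, hai, hkj, hlt'⟩
      omega
    · have e1 : a = i := Fin.ext (by omega)
      have e2 : k = j := Fin.ext (by omega)
      subst e1 e2
      exact ⟨b, h2, hab⟩
  · right
    have hki : (k : ℕ) ≤ i := by omega
    have := hmin (k, b)
    simp only at this
    by_cases hlt' : (j : ℕ) - i < b - k
    · have := this ⟨h2, hki, hjb, hlt'⟩
      omega
    · have e1 : b = j := Fin.ext (by omega)
      have e2 : k = i := Fin.ext (by omega)
      subst e1 e2
      exact ⟨a, h1, hab⟩

/-- Flips: a diagonal of a maximal dissection can be replaced. -/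
lemma exists_flip (hD : Maximal IsDissection D) {d : Fin m × Fin m} (hd : d ∈ D) :
    ∃ D', Maximal IsDissection D' ∧ D.erase d ⊆ D' ∧ d ∉ D' := by
  classical
  obtain ⟨i, j⟩ := d
  have hij := hD.prop.isArc hd
  have hdiag := hD.prop.1 _ hd
  simp only [IsDiagonal] at hij hdiag
  obtain ⟨k, hik, hkj, h1, h2⟩ := exists_apex hD hij hdiag.1
  -- The two triangles at `(i, j)` form a quadrilateral, and `d'` is its other diagonal. An arc
  -- other than `(i, j)` that crosses `d'` would cross a side of the quadrilateral.
  obtain ⟨d', hd', hcross, hother⟩ : ∃ d' : Fin m × Fin m, IsDiagonal d' ∧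
      DiagonalsCross (i, j) d' ∧ ∀ e ∈ D, e ≠ (i, j) →
        ¬ DiagonalsCross e d' ∧ ¬ DiagonalsCross d' e := by
    rcases exists_outer_apex hD hd with ⟨b, h3, h4⟩ | ⟨a, h3, h4⟩
    · have l3 := h3.lt
      have l4 := h4.lt
      have lb := b.2
      refine ⟨(k, b), ⟨by simp only; omega, by simp only; omega⟩, Or.inl ⟨hik, hkj, l3⟩, ?_⟩
      rintro ⟨x, y⟩ he hne
      have hxy := hD.prop.isArc he
      have hne' : ¬ ((x : ℕ) = i ∧ (y : ℕ) = j) := fun h =>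
        hne (Prod.ext (Fin.ext h.1) (Fin.ext h.2))
      have := hD.prop.not_cross hxy h1
      have := hD.prop.not_cross hxy h2
      have := hD.prop.not_cross hxy h3
      have := hD.prop.not_cross hxy h4
      have := hD.prop.not_cross h1 hxy
      have := hD.prop.not_cross h2 hxy
      have := hD.prop.not_cross h3 hxy
      have := hD.prop.not_cross h4 hxy
      simp only [DiagonalsCross, Fin.lt_def]
      simp only at *
      omega
    · have l3 := h3.lt
      have l4 := h4.lt
      have lj := j.2
      refine ⟨(a, k), ⟨by simp only; omega, by simp only; omega⟩, Or.inr ⟨l3, hik, hkj⟩, ?_⟩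
      rintro ⟨x, y⟩ he hne
      have hxy := hD.prop.isArc he
      have hne' : ¬ ((x : ℕ) = i ∧ (y : ℕ) = j) := fun h =>
        hne (Prod.ext (Fin.ext h.1) (Fin.ext h.2))
      have := hD.prop.not_cross hxy h1
      have := hD.prop.not_cross hxy h2
      have := hD.prop.not_cross hxy h3
      have := hD.prop.not_cross hxy h4
      have := hD.prop.not_cross h1 hxy
      have := hD.prop.not_cross h2 hxy
      have := hD.prop.not_cross h3 hxy
      have := hD.prop.not_cross h4 hxy
      simp only [DiagonalsCross, Fin.lt_def]
      simp only at *
      omega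
  have hgood : IsDissection (insert d' (D.erase (i, j))) := by
    refine ⟨?_, ?_⟩
    · intro e he
      rcases Finset.mem_insert.1 he with rfl | he
      · exact hd'
      · exact hD.prop.1 e (Finset.mem_of_mem_erase he)
    · intro e he e' he'
      rcases Finset.mem_insert.1 he with h1 | he <;>
        rcases Finset.mem_insert.1 he' with h2 | he'
      · subst h1 h2
        simp only [DiagonalsCross, Fin.lt_def]
        omega
      · rw [h1]
        exact (hother _ (Finset.mem_of_mem_erase he') (Finset.ne_of_mem_erase he')).2
      · rw [h2]
        exact (hother _ (Finset.mem_of_mem_erase he) (Finset.ne_of_mem_erase he)).1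
      · exact hD.prop.2 e (Finset.mem_of_mem_erase he) e' (Finset.mem_of_mem_erase he')
  -- Any maximal extension will do: it contains `d'`, which crosses `d`, and so omits `d`.
  obtain ⟨D', hle, hmax⟩ := Finite.exists_le_maximal hgood
  exact ⟨D', hmax, fun e he => hle (Finset.mem_insert_of_mem he), fun h =>
    hmax.prop.2 _ h _ (hle (Finset.mem_insert_self _ _)) hcross⟩

/-- Three arcs forming a triangle. -/
def IsArcTriangle (D : Finset (Fin m × Fin m)) (i k j : Fin m) : Prop :=
  IsArc D i k ∧ IsArc D k j ∧ IsArc D i j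

/-- Two distinct triangles of a dissection are separated by a diagonal. -/
lemma IsDissection.exists_separating (hD : IsDissection D) {i k j i' k' j' : Fin m}
    (h : IsArcTriangle D i k j) (h' : IsArcTriangle D i' k' j') (hne : (k : ℕ) < k') :
    ∃ d ∈ D,
      ((∀ s ∈ ({i, k, j} : Finset (Fin m)), (d.1 : ℕ) ≤ s ∧ (s : ℕ) ≤ d.2) ∧
        ∀ s ∈ ({i', k', j'} : Finset (Fin m)), (s : ℕ) ≤ d.1 ∨ (d.2 : ℕ) ≤ s) ∨
      ((∀ s ∈ ({i', k', j'} : Finset (Fin m)), (d.1 : ℕ) ≤ s ∧ (s : ℕ) ≤ d.2) ∧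
        ∀ s ∈ ({i, k, j} : Finset (Fin m)), (s : ℕ) ≤ d.1 ∨ (d.2 : ℕ) ≤ s) := by
  obtain ⟨h1, h2, h3⟩ := h
  obtain ⟨h1', h2', h3'⟩ := h'
  have l1 := h1.lt
  have l2 := h2.lt
  have l1' := h1'.lt
  have l2' := h2'.lt
  have c1 := hD.not_cross h3 h1'
  have c2 := hD.not_cross h3 h2'
  have c3 := hD.not_cross h3 h3'
  have c4 := hD.not_cross h1' h2
  have c5 := hD.not_cross h1' h3
  have c6 := hD.not_cross h3' h3
  have c7 := hD.not_cross h2 h2'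
  have hj := j.2
  have hj' := j'.2
  simp only [Finset.mem_insert, Finset.mem_singleton, forall_eq_or_imp, forall_eq]
  -- The three cases: the second triangle lies below `(k, j)`; the first is cut off by its own base
  -- `(i, j)`; the first lies below `(i', k')`.
  by_cases hk : (k' : ℕ) < j
  · exact ⟨(k, j), h2.mem (by omega) (by omega), Or.inr (by simp only; omega)⟩
  · by_cases hi : (j : ℕ) ≤ i'
    · exact ⟨(i, j), h3.mem (by omega) (by omega), Or.inl (by simp only; omega)⟩
    · exact ⟨(i', k'), h1'.mem (by omega) (by omega), Or.inl (by simp only; omega)⟩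

end Combinatorics

/-! ### Signed areas and barycentric coordinates in the plane -/

/-- Twice the signed area of the triangle `a b x`, as an affine function of `x`. -/
noncomputable def bracket (a b : Plane) : Plane →ᵃ[ℝ] ℝ where
  toFun x := (b 0 - a 0) * (x 1 - a 1) - (b 1 - a 1) * (x 0 - a 0)
  linear :=
    { toFun := fun v => (b 0 - a 0) * v 1 - (b 1 - a 1) * v 0
      map_add' := fun v w => by simp only [PiLp.add_apply]; ring
      map_smul' := fun r v => by simp only [PiLp.smul_apply, smul_eq_mul, RingHom.id_apply]; ring }
  map_vadd' x v := by simp only [vadd_eq_add, PiLp.add_apply, LinearMap.coe_mk, AddHom.coe_mk]; ring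

lemma bracket_apply (a b x : Plane) :
    bracket a b x = (b 0 - a 0) * (x 1 - a 1) - (b 1 - a 1) * (x 0 - a 0) := rfl

lemma bracket_rotate (a b c : Plane) : bracket b c a = bracket a b c := by
  simp only [bracket_apply]; ring

lemma bracket_swap (a b c : Plane) : bracket a c b = -bracket a b c := by
  simp only [bracket_apply]; ring

@[simp] lemma bracket_self_left (a b : Plane) : bracket a b a = 0 := by
  simp only [bracket_apply]; ring

@[simp] lemma bracket_self_right (a b : Plane) : bracket a b b = 0 := by
  simp only [bracket_apply]; ring

lemma bracket_add (a b c x : Plane) :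
    bracket b c x + bracket c a x + bracket a b x = bracket a b c := by
  simp only [bracket_apply]; ring

lemma bracket_smul_add (a b c x : Plane) :
    bracket b c x • a + bracket c a x • b + bracket a b x • c = bracket a b c • x := by
  ext i
  fin_cases i <;> simp [bracket_apply] <;> ring

lemma collinear_iff_bracket_eq_zero (a b c : Plane) :
    Collinear ℝ ({a, b, c} : Set Plane) ↔ bracket a b c = 0 := by
  constructor
  · intro h
    obtain ⟨v, hv⟩ := (collinear_iff_of_mem (p₀ := a) (by simp)).1 h
    obtain ⟨r, hr⟩ := hv b (by simp)
    obtain ⟨s, hs⟩ := hv c (by simp)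
    rw [hr, hs, bracket_apply]
    simp
    ring
  · intro h
    by_cases hab : a = b
    · subst hab
      simpa using collinear_pair ℝ a c
    · rw [collinear_iff_of_mem (p₀ := a) (by simp)]
      refine ⟨b - a, ?_⟩
      simp only [Set.mem_insert_iff, Set.mem_singleton_iff, forall_eq_or_imp, forall_eq]
      refine ⟨⟨0, by simp⟩, ⟨1, by simp⟩, ?_⟩
      rw [bracket_apply] at h
      by_cases h0 : b 0 - a 0 = 0
      · have h1 : b 1 - a 1 ≠ 0 := by
          intro h1
          apply hab
          ext i
          fin_cases i
          · simp; linarith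
          · simp; linarith
        refine ⟨(c 1 - a 1) / (b 1 - a 1), ?_⟩
        have h2 : c 0 - a 0 = 0 := by
          rw [h0] at h
          simpa [h1] using h
        ext i
        fin_cases i
        · simp [h0]; linarith
        · simp; field_simp; ring
      · refine ⟨(c 0 - a 0) / (b 0 - a 0), ?_⟩
        ext i
        fin_cases i
        · simp; field_simp; ring
        · simp; field_simp; linarith

/-! ### Labelled convex hulls -/

section Hull

variable {ι : Type*} {p : ι → Plane}

lemma mem_hullOf {σ : Finset ι} {x : Plane} :
    x ∈ hullOf p σ ↔
      ∃ w : ι → ℝ, (∀ i ∈ σ, 0 ≤ w i) ∧ ∑ i ∈ σ, w i = 1 ∧ ∑ i ∈ σ, w i • p i = x := by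
  classical
  constructor
  · intro h
    refine convexHull_min (t := {x | ∃ w : ι → ℝ, (∀ i ∈ σ, 0 ≤ w i) ∧ ∑ i ∈ σ, w i = 1 ∧
      ∑ i ∈ σ, w i • p i = x}) ?_ ?_ h
    · rintro _ ⟨i, hi, rfl⟩
      have hi' : i ∈ σ := hi
      refine ⟨fun j => if j = i then 1 else 0, fun j _ => by dsimp only; split_ifs <;> norm_num, ?_, ?_⟩
      · simp [hi']
      · simp [ite_smul, hi']
    · rintro _ ⟨w, hw, hw1, rfl⟩ _ ⟨v, hv, hv1, rfl⟩ s t hs ht hst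
      refine ⟨fun i => s * w i + t * v i, fun i hi => ?_, ?_, ?_⟩
      · have := hw i hi
        have := hv i hi
        positivity
      · rw [Finset.sum_add_distrib, ← Finset.mul_sum, ← Finset.mul_sum, hw1, hv1]
        simpa using hst
      · simp only [add_smul, mul_smul, Finset.sum_add_distrib, Finset.smul_sum]
  · rintro ⟨w, hw, hw1, rfl⟩
    exact (convex_convexHull ℝ _).sum_mem hw hw1 fun i hi =>
      subset_convexHull ℝ _ ⟨i, hi, rfl⟩

lemma affineMap_sum {F : Type*} [AddCommGroup F] [Module ℝ F] (l : Plane →ᵃ[ℝ] F) {σ : Finset ι}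
    {w : ι → ℝ} (hw : ∑ i ∈ σ, w i = 1) :
    l (∑ i ∈ σ, w i • p i) = ∑ i ∈ σ, w i • l (p i) := by
  rw [← Finset.affineCombination_eq_linear_combination _ _ _ hw, Finset.map_affineCombination _ _ _ hw,
    Finset.affineCombination_eq_linear_combination _ _ _ hw]
  rfl

lemma isCompact_hullOf (σ : Finset ι) : IsCompact (hullOf p σ) :=
  (σ.finite_toSet.image p).isCompact_convexHull ℝ

lemma measurableSet_hullOf (σ : Finset ι) : MeasurableSet (hullOf p σ) :=
  (isCompact_hullOf σ).measurableSet

lemma hullOf_mono {σ τ : Finset ι} (h : σ ⊆ τ) : hullOf p σ ⊆ hullOf p τ :=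
  convexHull_mono (Set.image_mono h)

lemma mem_hullOf_of_mem {σ : Finset ι} {i : ι} (h : i ∈ σ) : p i ∈ hullOf p σ :=
  subset_convexHull ℝ _ ⟨i, h, rfl⟩

lemma convex_hullOf (σ : Finset ι) : Convex ℝ (hullOf p σ) := convex_convexHull ℝ _

lemma volume_hullOf_of_collinear {σ : Finset ι} (h : Collinear ℝ (p '' (σ : Set ι))) :
    MeasureTheory.volume (hullOf p σ) = 0 := by
  have hne : affineSpan ℝ (p '' (σ : Set ι)) ≠ ⊤ := by
    intro htop
    have h1 := collinear_iff_finrank_le_one.1 h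
    rw [← direction_affineSpan, htop, AffineSubspace.direction_top, finrank_top] at h1
    simp at h1
  exact MeasureTheory.measure_mono_null (convexHull_subset_affineSpan (𝕜 := ℝ) _)
    (MeasureTheory.Measure.addHaar_affineSubspace _ _ hne)

lemma collinear_of_card_le_two {σ : Finset ι} (h : σ.card ≤ 2) :
    Collinear ℝ (p '' (σ : Set ι)) := by
  classical
  rcases σ.eq_empty_or_nonempty with rfl | hne
  · simp [collinear_empty]
  · have hpos := hne.card_pos
    have := finrank_vectorSpan_image_finset_le ℝ p σ (n := σ.card - 1) (by omega)
    rw [collinear_iff_finrank_le_one]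
    rw [Finset.coe_image] at this
    omega

lemma affineIndependent_iff_not_collinear_image {σ : Finset ι} (hσ : σ.card = 3) :
    AffineIndependent ℝ (fun i : σ => p i) ↔ ¬ Collinear ℝ (p '' (σ : Set ι)) := by
  rw [collinear_iff_finrank_le_one, affineIndependent_iff_not_finrank_vectorSpan_le ℝ (n := 1) _
    (by simpa using hσ)]
  have : Set.range (fun i : σ => p i) = p '' (σ : Set ι) := by
    ext x; simp
  rw [this]

lemma image_insert_three [DecidableEq ι] (i j k : ι) :
    p '' (({i, j, k} : Finset ι) : Set ι) = {p i, p j, p k} := by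
  simp [Set.image_insert_eq]

lemma affineIndependent_iff_bracket_ne_zero [DecidableEq ι] {i j k : ι}
    (h : ({i, j, k} : Finset ι).card = 3) :
    AffineIndependent ℝ (fun s : ({i, j, k} : Finset ι) => p s) ↔
      bracket (p i) (p j) (p k) ≠ 0 := by
  rw [affineIndependent_iff_not_collinear_image h, image_insert_three,
    collinear_iff_bracket_eq_zero]

lemma integrableOn_hullOf {g : Plane → ℝ} (hg : Continuous g) (σ : Finset ι) :
    MeasureTheory.IntegrableOn g (hullOf p σ) :=
  hg.continuousOn.integrableOn_compact (isCompact_hullOf σ)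

lemma continuous_max_zero_affineMap (l : Plane →ᵃ[ℝ] ℝ) : Continuous fun x => max 0 (l x) :=
  continuous_const.max l.continuous_of_finiteDimensional

lemma affineMap_nonneg_of_mem_hullOf {σ : Finset ι} {l : Plane →ᵃ[ℝ] ℝ}
    (h : ∀ i ∈ σ, 0 ≤ l (p i)) {x : Plane}
    (hx : x ∈ hullOf p σ) : 0 ≤ l x := by
  obtain ⟨w, hw, hw1, rfl⟩ := mem_hullOf.1 hx
  rw [affineMap_sum l hw1]
  exact Finset.sum_nonneg fun i hi => mul_nonneg (hw i hi) (h i hi)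

end Hull

/-! ### Integrals of affine functions over triangles -/

open MeasureTheory in
-- The change of variables formula for the constant function 1 forces the determinant of `ρ` to have
-- absolute value 1, since `S` has finite nonzero area.
lemma setIntegral_comp_affineMap {ρ : Plane →ᵃ[ℝ] Plane} (hρ : Function.Injective ρ)
    {S : Set Plane} (hS : MeasurableSet S) (himg : ρ '' S = S) (hvol : volume.real S ≠ 0)
    (g : Plane → ℝ) : ∫ x in S, g (ρ x) = ∫ x in S, g x := by
  have hder : ∀ x ∈ S, HasFDerivWithinAt ρ (LinearMap.toContinuousLinearMap ρ.linear) S x := by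
    intro x _
    have h1 : (ρ : Plane → Plane) = fun x => LinearMap.toContinuousLinearMap ρ.linear x + ρ 0 := by
      ext1 x
      exact congrFun (AffineMap.decomp ρ) x
    rw [h1]
    exact ((LinearMap.toContinuousLinearMap ρ.linear).hasFDerivAt.add_const _).hasFDerivWithinAt
  have key := fun g : Plane → ℝ =>
    integral_image_eq_integral_abs_det_fderiv_smul volume hS hder hρ.injOn g
  rw [himg] at key
  have h1 := key fun _ => 1
  simp only [smul_eq_mul, mul_one, setIntegral_const] at h1
  have h2 : |(LinearMap.toContinuousLinearMap ρ.linear).det| = 1 :=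
    (mul_left_cancel₀ hvol (by rw [mul_one]; exact h1)).symm
  rw [key g, h2]
  simp

section Triangle

open MeasureTheory

variable {a b c : Plane}

/-- The barycentric coordinate of `x` at `a` with respect to the triangle `a b c`. -/
noncomputable def baryCoord (a b c : Plane) : Plane →ᵃ[ℝ] ℝ := (bracket a b c)⁻¹ • bracket b c

lemma baryCoord_apply (a b c x : Plane) :
    baryCoord a b c x = (bracket a b c)⁻¹ * bracket b c x := rfl

lemma baryCoord_add (h : bracket a b c ≠ 0) (x : Plane) :
    baryCoord a b c x + baryCoord b c a x + baryCoord c a b x = 1 := by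
  simp only [baryCoord_apply, bracket_rotate a b c, ← bracket_rotate c a b]
  rw [← mul_add, ← mul_add, bracket_add, inv_mul_cancel₀ h]

lemma baryCoord_smul_add (h : bracket a b c ≠ 0) (x : Plane) :
    baryCoord a b c x • a + baryCoord b c a x • b + baryCoord c a b x • c = x := by
  simp only [baryCoord_apply, bracket_rotate a b c, ← bracket_rotate c a b, mul_smul]
  rw [← smul_add, ← smul_add, bracket_smul_add, smul_smul, inv_mul_cancel₀ h, one_smul]

lemma affineMap_eq_baryCoord {F : Type*} [AddCommGroup F] [Module ℝ F]
    (h : bracket a b c ≠ 0) (l : Plane →ᵃ[ℝ] F) (x : Plane) :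
    l x = baryCoord a b c x • l a + baryCoord b c a x • l b + baryCoord c a b x • l c := by
  have h1 := affineMap_sum l (p := ![a, b, c]) (σ := Finset.univ)
    (w := ![baryCoord a b c x, baryCoord b c a x, baryCoord c a b x])
    (by simpa [Fin.sum_univ_three] using baryCoord_add h x)
  simp only [Fin.sum_univ_three, Matrix.cons_val_zero, Matrix.cons_val_one, Matrix.cons_val] at h1
  rwa [baryCoord_smul_add h] at h1

@[simp] lemma baryCoord_self (h : bracket a b c ≠ 0) : baryCoord a b c a = 1 := by
  rw [baryCoord_apply, bracket_rotate a b c, inv_mul_cancel₀ h]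

@[simp] lemma baryCoord_left : baryCoord a b c b = 0 := by simp [baryCoord_apply]

@[simp] lemma baryCoord_right : baryCoord a b c c = 0 := by simp [baryCoord_apply]

lemma mem_triangle_iff (h : bracket a b c ≠ 0) (x : Plane) :
    x ∈ convexHull ℝ ({a, b, c} : Set Plane) ↔
      0 ≤ baryCoord a b c x ∧ 0 ≤ baryCoord b c a x ∧ 0 ≤ baryCoord c a b x := by
  have hb : bracket b c a ≠ 0 := by rwa [bracket_rotate]
  have hc : bracket c a b ≠ 0 := by rwa [← bracket_rotate]
  constructor
  · intro hx
    refine convexHull_min (t := {x | 0 ≤ baryCoord a b c x ∧ 0 ≤ baryCoord b c a x ∧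
      0 ≤ baryCoord c a b x}) ?_ ?_ hx
    · rintro x (rfl | rfl | rfl) <;> simp [h, hb, hc]
    · exact ((convex_Ici (0 : ℝ)).affine_preimage (baryCoord a b c)).inter
        (((convex_Ici (0 : ℝ)).affine_preimage (baryCoord b c a)).inter
          ((convex_Ici (0 : ℝ)).affine_preimage (baryCoord c a b)))
  · rintro ⟨h1, h2, h3⟩
    have h4 := (convex_convexHull ℝ ({a, b, c} : Set Plane)).sum_mem (t := Finset.univ)
      (w := ![baryCoord a b c x, baryCoord b c a x, baryCoord c a b x]) (z := ![a, b, c])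
      (by simpa [Fin.forall_fin_succ] using ⟨h1, h2, h3⟩)
      (by simpa [Fin.sum_univ_three] using baryCoord_add h x)
      (by
        have := subset_convexHull ℝ ({a, b, c} : Set Plane)
        simp only [Set.insert_subset_iff, Set.singleton_subset_iff] at this
        simpa [Fin.forall_fin_succ] using this)
    simp only [Fin.sum_univ_three, Matrix.cons_val_zero, Matrix.cons_val_one,
      Matrix.cons_val] at h4
    rwa [baryCoord_smul_add h] at h4

lemma interior_triangle_nonempty (h : bracket a b c ≠ 0) :
    (interior (convexHull ℝ ({a, b, c} : Set Plane))).Nonempty := by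
  have hb : bracket b c a ≠ 0 := by rwa [bracket_rotate]
  have hc : bracket c a b ≠ 0 := by rwa [← bracket_rotate]
  set S := {x | 0 < baryCoord a b c x ∧ 0 < baryCoord b c a x ∧ 0 < baryCoord c a b x} with hS
  have hcont : ∀ l : Plane →ᵃ[ℝ] ℝ, Continuous l := fun l => l.continuous_of_finiteDimensional
  have hopen : IsOpen S :=
    (isOpen_lt continuous_const (hcont _)).inter ((isOpen_lt continuous_const (hcont _)).inter
      (isOpen_lt continuous_const (hcont _)))
  have hsub : S ⊆ convexHull ℝ ({a, b, c} : Set Plane) := fun x hx =>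
    (mem_triangle_iff h x).2 ⟨hx.1.le, hx.2.1.le, hx.2.2.le⟩
  have hcentroid : ∀ l : Plane →ᵃ[ℝ] ℝ,
      l (∑ i : Fin 3, (1 / 3 : ℝ) • ![a, b, c] i) = 1 / 3 * (l a + l b + l c) := by
    intro l
    have := affineMap_sum l (p := ![a, b, c]) (σ := Finset.univ) (w := fun _ => 1 / 3) (by simp)
    rw [this]
    simp only [Fin.sum_univ_three, Matrix.cons_val_zero, Matrix.cons_val_one,
      Matrix.cons_val, smul_eq_mul]
    ring
  refine ⟨∑ i : Fin 3, (1 / 3 : ℝ) • ![a, b, c] i, interior_mono hsub ?_⟩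
  rw [hopen.interior_eq]
  refine ⟨?_, ?_, ?_⟩ <;> rw [hcentroid] <;> simp [h, hb, hc]

lemma isCompact_triangle (a b c : Plane) : IsCompact (convexHull ℝ ({a, b, c} : Set Plane)) :=
  (Set.toFinite _).isCompact_convexHull ℝ

lemma volume_triangle_pos (h : bracket a b c ≠ 0) :
    0 < volume.real (convexHull ℝ ({a, b, c} : Set Plane)) := by
  refine ENNReal.toReal_pos ?_ (isCompact_triangle a b c).measure_lt_top.ne
  have := isOpen_interior.measure_pos volume (interior_triangle_nonempty h)
  exact (this.trans_le (measure_mono interior_subset)).ne'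

lemma setIntegral_baryCoord_eq (h : bracket a b c ≠ 0) :
    ∫ x in convexHull ℝ ({a, b, c} : Set Plane), baryCoord a b c x =
      ∫ x in convexHull ℝ ({a, b, c} : Set Plane), baryCoord b c a x := by
  have hb : bracket b c a ≠ 0 := by rwa [bracket_rotate]
  have hc : bracket c a b ≠ 0 := by rwa [← bracket_rotate]
  -- The affine involution that swaps `a` and `b` and fixes `c`; it preserves the triangle and
  -- exchanges the two coordinates.
  let ρ : Plane →ᵃ[ℝ] Plane := AffineMap.id ℝ Plane +
    (LinearMap.toSpanSingleton ℝ Plane (b - a)).toAffineMap.comp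
      (baryCoord a b c - baryCoord b c a)
  have hρ : ∀ x, ρ x = x + (baryCoord a b c x - baryCoord b c a x) • (b - a) := fun x => by
    simp [ρ, sub_smul]
  have ha : ρ a = b := by rw [hρ]; simp [h]
  have hb' : ρ b = a := by rw [hρ]; simp [hb]
  have hc' : ρ c = c := by rw [hρ]; simp
  have e1 : ∀ x, baryCoord a b c (ρ x) = baryCoord b c a x := fun x => by
    have := affineMap_eq_baryCoord h ((baryCoord a b c).comp ρ) x
    simpa [ha, hb', hc', h] using this
  have hinv : Function.Involutive ρ := fun x => by
    have := affineMap_eq_baryCoord h (ρ.comp ρ) x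
    simp only [AffineMap.comp_apply, ha, hb', hc', baryCoord_smul_add h] at this
    exact this
  have himg : ρ '' convexHull ℝ ({a, b, c} : Set Plane) = convexHull ℝ ({a, b, c} : Set Plane) := by
    rw [AffineMap.image_convexHull, Set.image_insert_eq, Set.image_pair, ha, hb', hc',
      Set.insert_comm]
  rw [← setIntegral_comp_affineMap hinv.injective (isCompact_triangle a b c).measurableSet himg
    (volume_triangle_pos h).ne']
  simp only [e1]

/-- By symmetry the three coordinates have equal integrals, and they sum to 1. -/
lemma setIntegral_baryCoord (h : bracket a b c ≠ 0) :
    ∫ x in convexHull ℝ ({a, b, c} : Set Plane), baryCoord a b c x =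
      volume.real (convexHull ℝ ({a, b, c} : Set Plane)) / 3 := by
  have hb : bracket b c a ≠ 0 := by rwa [bracket_rotate]
  have h1 := setIntegral_baryCoord_eq h
  have h2 := setIntegral_baryCoord_eq hb
  have hset : ({b, c, a} : Set Plane) = {a, b, c} := by
    ext; simp only [Set.mem_insert_iff, Set.mem_singleton_iff]; tauto
  rw [hset] at h2
  have hint : ∀ l : Plane →ᵃ[ℝ] ℝ,
      IntegrableOn l (convexHull ℝ ({a, b, c} : Set Plane)) := fun l =>
    l.continuous_of_finiteDimensional.continuousOn.integrableOn_compact (isCompact_triangle a b c)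
  have h3 : ∫ x in convexHull ℝ ({a, b, c} : Set Plane),
      (baryCoord a b c x + baryCoord b c a x + baryCoord c a b x) =
      volume.real (convexHull ℝ ({a, b, c} : Set Plane)) := by
    simp [baryCoord_add h]
  rw [integral_add (f := fun x => baryCoord a b c x + baryCoord b c a x)
    ((hint _).add (hint _)) (hint _), integral_add (hint _) (hint _)] at h3
  linarith

/-- The integral of an affine function over a triangle is the area times the mean of the values
at the vertices. -/
lemma setIntegral_triangle (h : bracket a b c ≠ 0) (l : Plane →ᵃ[ℝ] ℝ) :
    ∫ x in convexHull ℝ ({a, b, c} : Set Plane), l x =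
      volume.real (convexHull ℝ ({a, b, c} : Set Plane)) / 3 * (l a + l b + l c) := by
  have hb : bracket b c a ≠ 0 := by rwa [bracket_rotate]
  have h0 := setIntegral_baryCoord h
  have h1 := setIntegral_baryCoord_eq h
  have h2 := setIntegral_baryCoord_eq hb
  have hset : ({b, c, a} : Set Plane) = {a, b, c} := by
    ext; simp only [Set.mem_insert_iff, Set.mem_singleton_iff]; tauto
  rw [hset] at h2
  have hint : ∀ (l : Plane →ᵃ[ℝ] ℝ) (r : ℝ),
      IntegrableOn (fun x => l x • r) (convexHull ℝ ({a, b, c} : Set Plane)) := fun l r =>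
    (l.continuous_of_finiteDimensional.smul continuous_const).continuousOn.integrableOn_compact
      (isCompact_triangle a b c)
  rw [integral_congr_ae (ae_of_all _ (affineMap_eq_baryCoord h l))]
  rw [integral_add (f := fun x => baryCoord a b c x • l a + baryCoord b c a x • l b)
    ((hint _ _).add (hint _ _)) (hint _ _), integral_add (hint _ _) (hint _ _),
    integral_smul_const, integral_smul_const, integral_smul_const, ← h2, ← h1, h0]
  simp only [smul_eq_mul]
  ring

end Triangle

/-! ### Weights paired with the GKZ vector of a triangulation -/

section Triangulation

open MeasureTheory

variable {ι : Type*} [DecidableEq ι] {p : ι → Plane} {σ : Finset ι}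

lemma exists_bracket_ne_zero (hσ : σ.card = 3) (h : AffineIndependent ℝ (fun i : σ => p i)) :
    ∃ i j k, i ≠ j ∧ i ≠ k ∧ j ≠ k ∧ σ = {i, j, k} ∧ bracket (p i) (p j) (p k) ≠ 0 := by
  obtain ⟨i, j, k, hij, hik, hjk, rfl⟩ := Finset.card_eq_three.1 hσ
  exact ⟨i, j, k, hij, hik, hjk, rfl, (affineIndependent_iff_bracket_ne_zero hσ).1 h⟩

lemma hullOf_three (i j k : ι) : hullOf p {i, j, k} = convexHull ℝ {p i, p j, p k} := by
  rw [hullOf, image_insert_three]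

lemma triangleArea_pos (hσ : σ.card = 3) (h : AffineIndependent ℝ (fun i : σ => p i)) :
    0 < triangleArea p σ := by
  obtain ⟨i, j, k, hij, hik, hjk, rfl, hb⟩ := exists_bracket_ne_zero hσ h
  rw [triangleArea, hullOf_three]
  exact volume_triangle_pos hb

lemma interior_hullOf_nonempty (hσ : σ.card = 3) (h : AffineIndependent ℝ (fun i : σ => p i)) :
    (interior (hullOf p σ)).Nonempty := by
  obtain ⟨i, j, k, hij, hik, hjk, rfl, hb⟩ := exists_bracket_ne_zero hσ h
  rw [hullOf_three]
  exact interior_triangle_nonempty hb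

lemma setIntegral_hullOf (hσ : σ.card = 3) (h : AffineIndependent ℝ (fun i : σ => p i))
    (l : Plane →ᵃ[ℝ] ℝ) :
    3 * ∫ x in hullOf p σ, l x = triangleArea p σ * ∑ i ∈ σ, l (p i) := by
  obtain ⟨i, j, k, hij, hik, hjk, rfl, hb⟩ := exists_bracket_ne_zero hσ h
  rw [triangleArea, hullOf_three, setIntegral_triangle hb, Finset.sum_insert (by simp [hij, hik]),
    Finset.sum_pair hjk]
  ring

lemma exists_affine_interpolation (hσ : σ.card = 3)
    (h : AffineIndependent ℝ (fun i : σ => p i)) (g : ι → ℝ) :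
    ∃ l : Plane →ᵃ[ℝ] ℝ, ∀ i ∈ σ, l (p i) = g i := by
  obtain ⟨i, j, k, hij, hik, hjk, rfl, hb⟩ := exists_bracket_ne_zero hσ h
  have hb' : bracket (p j) (p k) (p i) ≠ 0 := by rwa [bracket_rotate]
  have hb'' : bracket (p k) (p i) (p j) ≠ 0 := by rwa [← bracket_rotate]
  refine ⟨g i • baryCoord (p i) (p j) (p k) + g j • baryCoord (p j) (p k) (p i) +
    g k • baryCoord (p k) (p i) (p j), ?_⟩
  simp [hb, hb', hb'']

/-- Where `l` does not change sign, its positive part is affine on the triangle. -/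
lemma setIntegral_posPart_of_nonneg (hσ : σ.card = 3)
    (h : AffineIndependent ℝ (fun i : σ => p i)) (l : Plane →ᵃ[ℝ] ℝ)
    (hl : (∀ i ∈ σ, 0 ≤ l (p i)) ∨ ∀ i ∈ σ, l (p i) ≤ 0) :
    3 * ∫ x in hullOf p σ, max 0 (l x) = triangleArea p σ * ∑ i ∈ σ, max 0 (l (p i)) := by
  rcases hl with hl | hl
  · rw [Finset.sum_congr rfl fun i hi => max_eq_right (hl i hi), ← setIntegral_hullOf hσ h l,
      setIntegral_congr_fun (measurableSet_hullOf σ) fun x hx =>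
        max_eq_right (affineMap_nonneg_of_mem_hullOf hl hx)]
  · have hneg : ∀ x ∈ hullOf p σ, l x ≤ 0 := fun x hx => by
      have := affineMap_nonneg_of_mem_hullOf (l := -l) (fun i hi => by simpa using hl i hi) hx
      simpa using this
    rw [Finset.sum_congr rfl fun i hi => max_eq_left (hl i hi),
      setIntegral_congr_fun (measurableSet_hullOf σ) fun x hx => max_eq_left (hneg x hx)]
    simp

/-- The positive part of `l` is convex, so it lies below its affine interpolant `L` at the vertices.
The inequality is strict where `l` vanishes on the edge from `p i` to `p j`, hence on a set of
positive area nearby. -/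
lemma setIntegral_posPart_lt (hσ : σ.card = 3)
    (h : AffineIndependent ℝ (fun i : σ => p i)) (l : Plane →ᵃ[ℝ] ℝ) {i j : ι} (hi : i ∈ σ)
    (hj : j ∈ σ) (hli : 0 < l (p i)) (hlj : l (p j) < 0) :
    3 * ∫ x in hullOf p σ, max 0 (l x) < triangleArea p σ * ∑ i ∈ σ, max 0 (l (p i)) := by
  obtain ⟨L, hL⟩ := exists_affine_interpolation hσ h fun i => max 0 (l (p i))
  rw [← Finset.sum_congr rfl hL, ← setIntegral_hullOf hσ h L]
  have hcl := continuous_max_zero_affineMap l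
  have hcL : Continuous L := L.continuous_of_finiteDimensional
  have hge : ∀ x ∈ hullOf p σ, max 0 (l x) ≤ L x := by
    intro x hx
    refine max_le ?_ ?_
    · exact affineMap_nonneg_of_mem_hullOf (fun i hi => by rw [hL i hi]; exact le_max_left _ _) hx
    · have := affineMap_nonneg_of_mem_hullOf (l := L - l) (fun i hi => by
        change 0 ≤ L (p i) - l (p i)
        rw [hL i hi]; exact sub_nonneg.2 (le_max_right _ _)) hx
      simpa using this
  have hpos : 0 < ∫ x in hullOf p σ, (L x - max 0 (l x)) := by
    rw [setIntegral_pos_iff_support_of_nonneg_ae]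
    · obtain ⟨y, hy, hLy, hly⟩ : ∃ y ∈ hullOf p σ, 0 < L y ∧ l y = 0 := by
        have hd : 0 < l (p i) - l (p j) := by linarith
        have hline : ∀ l' : Plane →ᵃ[ℝ] ℝ, l' (AffineMap.lineMap (p i) (p j)
            (l (p i) / (l (p i) - l (p j)))) = l' (p i) +
              (l (p i) / (l (p i) - l (p j))) * (l' (p j) - l' (p i)) := by
          intro l'
          rw [AffineMap.apply_lineMap, AffineMap.lineMap_apply]
          simp only [vsub_eq_sub, smul_eq_mul, vadd_eq_add]
          ring
        refine ⟨AffineMap.lineMap (p i) (p j) (l (p i) / (l (p i) - l (p j))), ?_, ?_, ?_⟩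
        · refine (convex_hullOf σ).segment_subset (mem_hullOf_of_mem hi) (mem_hullOf_of_mem hj) ?_
          rw [segment_eq_image_lineMap]
          exact ⟨_, ⟨by positivity, by rw [div_le_one hd]; linarith⟩, rfl⟩
        · rw [hline, hL i hi, hL j hj, max_eq_right hli.le, max_eq_left hlj.le]
          have : l (p i) + l (p i) / (l (p i) - l (p j)) * (0 - l (p i)) =
              l (p i) * (-l (p j)) / (l (p i) - l (p j)) := by
            field_simp
            ring
          rw [this]
          exact div_pos (mul_pos hli (by linarith)) hd
        · rw [hline]
          field_simp
          ring
      have hopen : IsOpen {x | max 0 (l x) < L x} := isOpen_lt hcl hcL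
      -- The point `y` lies on an edge, so a neighbourhood of it need not stay in the triangle;
      -- being a limit of interior points is enough.
      have hyc : y ∈ closure (interior (hullOf p σ)) := by
        rw [(convex_hullOf σ).closure_interior_eq_closure_of_nonempty_interior
          (interior_hullOf_nonempty hσ h)]
        exact subset_closure hy
      have hne := mem_closure_iff.1 hyc _ hopen (by
        change max 0 (l y) < L y
        rw [hly]; simpa using hLy)
      refine ((hopen.inter isOpen_interior).measure_pos volume hne).trans_le (measure_mono ?_)
      rintro x ⟨hx1, hx2⟩
      exact ⟨(sub_pos.2 hx1).ne', interior_subset hx2⟩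
    · refine (ae_restrict_iff' (measurableSet_hullOf σ)).2 (ae_of_all _ fun x hx => ?_)
      exact sub_nonneg.2 (hge x hx)
    · exact integrableOn_hullOf (hcL.sub hcl) σ
  rw [integral_sub (integrableOn_hullOf hcL σ) (integrableOn_hullOf hcl σ)] at hpos
  linarith

variable {T : Finset (Finset ι)}

/-- Distinct triangles share at most two vertices, so their common face has area zero. -/
lemma IsTriangulation.setIntegral_eq_sum (hT : IsTriangulation p T) {g : Plane → ℝ}
    (hg : Continuous g) :
    ∫ x in convexHull ℝ (Set.range p), g x = ∑ σ ∈ T, ∫ x in hullOf p σ, g x := by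
  have hU : (⋃ σ ∈ T, hullOf p σ) = ⋃ σ : T, hullOf p (σ : Finset ι) := by
    ext x
    simp
  rw [← hT.cover, hU, ← Finset.sum_coe_sort, ← tsum_fintype (L := .unconditional _)]
  refine integral_iUnion_ae (fun σ => (measurableSet_hullOf σ.1).nullMeasurableSet) ?_ ?_
  · rintro ⟨σ, hσ⟩ ⟨τ, hτ⟩ hne
    change volume (hullOf p σ ∩ hullOf p τ) = 0
    rw [hT.inter σ hσ τ hτ]
    refine volume_hullOf_of_collinear (collinear_of_card_le_two ?_)
    by_contra hcard
    have h1 := hT.card_eq σ hσ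
    have h2 := hT.card_eq τ hτ
    have h3 : σ ∩ τ = σ := Finset.eq_of_subset_of_card_le Finset.inter_subset_left (by omega)
    have h4 : σ ∩ τ = τ := Finset.eq_of_subset_of_card_le Finset.inter_subset_right (by omega)
    exact hne (Subtype.ext (h3.symm.trans h4))
  · exact integrableOn_finite_iUnion.2 fun σ => integrableOn_hullOf hg σ.1

/-- The coefficient of `f i` in the GKZ vector of `T`. -/
noncomputable def gkzCoeff (p : ι → Plane) (T : Finset (Finset ι)) (i : ι) : ℝ :=
  ∑ σ ∈ T with i ∈ σ, triangleArea p σ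

/-- Regrouping by triangles turns the pairing into a sum of local terms. For a triangulation, each
term is three times the integral of the affine interpolant of `w` on its triangle. -/
lemma sum_mul_gkzCoeff [Fintype ι] (p : ι → Plane) (T : Finset (Finset ι)) (w : ι → ℝ) :
    ∑ i, w i * gkzCoeff p T i = ∑ σ ∈ T, triangleArea p σ * ∑ i ∈ σ, w i := by
  simp only [gkzCoeff, Finset.sum_filter, Finset.mul_sum]
  rw [Finset.sum_comm]
  refine Finset.sum_congr rfl fun σ _ => ?_
  simp only [mul_ite, mul_zero]
  rw [Finset.sum_ite_mem, Finset.univ_inter]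
  exact Finset.sum_congr rfl fun i _ => mul_comm _ _

lemma gkzVector_eq [Fintype ι] {E : Type*} [AddCommGroup E] [Module ℝ E] (p : ι → Plane)
    (f : ι → E) (T : Finset (Finset ι)) : gkzVector p f T = ∑ i, gkzCoeff p T i • f i := by
  simp only [gkzVector, gkzCoeff, Finset.sum_smul]

/-- Affine weights are constant on the GKZ vectors. -/
lemma IsTriangulation.sum_affine_mul_gkzCoeff [Fintype ι] (hT : IsTriangulation p T)
    (l : Plane →ᵃ[ℝ] ℝ) :
    ∑ i, l (p i) * gkzCoeff p T i = 3 * ∫ x in convexHull ℝ (Set.range p), l x := by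
  rw [sum_mul_gkzCoeff p T fun i => l (p i),
    hT.setIntegral_eq_sum l.continuous_of_finiteDimensional, Finset.mul_sum]
  exact Finset.sum_congr rfl fun σ hσ =>
    (setIntegral_hullOf (hT.card_eq σ hσ) (hT.affineIndependent σ hσ) l).symm

/-- All vertices of `σ` other than `i`, `j` lie strictly on one side of the line `p i p j`. -/
def LiesOnOneSide (p : ι → Plane) (i j : ι) (σ : Finset ι) : Prop :=
  (∀ k ∈ σ, k = i ∨ k = j ∨ 0 < bracket (p i) (p j) (p k)) ∨
    ∀ k ∈ σ, k = i ∨ k = j ∨ bracket (p i) (p j) (p k) < 0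

open Classical in
/-- The weight attached to the diagonal `i j`: the positive part of an affine function vanishing on
the diagonal, increased by one at the other points of the configuration on that line. -/
noncomputable def diagonalWeight (p : ι → Plane) (i j k : ι) : ℝ :=
  max 0 (bracket (p i) (p j) (p k)) +
    if k ≠ i ∧ k ≠ j ∧ bracket (p i) (p j) (p k) = 0 then 1 else 0

/-- The minimum of the weight of the diagonal `i j` on the GKZ vectors. -/
noncomputable def diagonalBound (p : ι → Plane) (i j : ι) : ℝ :=
  3 * ∫ x in convexHull ℝ (Set.range p), max 0 (bracket (p i) (p j) x)

/-- Two estimates are combined: convexity of the positive part, sharp when the bracket does not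
change sign on the vertices, and nonnegativity of the added 1, sharp when no vertex other than `i`,
`j` is on the line. Both are sharp exactly for a triangle strictly on one side. -/
lemma diagonalWeight_triangle (hσ : σ.card = 3)
    (h : AffineIndependent ℝ (fun i : σ => p i)) (i j : ι) :
    3 * ∫ x in hullOf p σ, max 0 (bracket (p i) (p j) x) ≤
        triangleArea p σ * ∑ k ∈ σ, diagonalWeight p i j k ∧
      (3 * ∫ x in hullOf p σ, max 0 (bracket (p i) (p j) x) =
        triangleArea p σ * ∑ k ∈ σ, diagonalWeight p i j k ↔ LiesOnOneSide p i j σ) := by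
  classical
  have hA := triangleArea_pos hσ h
  have hle : ∑ k ∈ σ, max 0 (bracket (p i) (p j) (p k)) ≤ ∑ k ∈ σ, diagonalWeight p i j k := by
    refine Finset.sum_le_sum fun k _ => ?_
    rw [diagonalWeight]
    split_ifs <;> simp
  by_cases hcross : ∃ k ∈ σ, ∃ k' ∈ σ, 0 < bracket (p i) (p j) (p k) ∧
      bracket (p i) (p j) (p k') < 0
  · obtain ⟨k, hk, k', hk', h1, h2⟩ := hcross
    have hlt := (setIntegral_posPart_lt hσ h _ hk hk' h1 h2).trans_le
      (mul_le_mul_of_nonneg_left hle hA.le)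
    refine ⟨hlt.le, iff_of_false hlt.ne ?_⟩
    rintro (h3 | h3)
    · rcases h3 k' hk' with rfl | rfl | h3
      · simp at h2
      · simp at h2
      · exact lt_asymm h2 h3
    · rcases h3 k hk with rfl | rfl | h3
      · simp at h1
      · simp at h1
      · exact lt_asymm h1 h3
  · have hside : (∀ k ∈ σ, 0 ≤ bracket (p i) (p j) (p k)) ∨
        ∀ k ∈ σ, bracket (p i) (p j) (p k) ≤ 0 := by
      by_contra hn
      push Not at hn hcross
      obtain ⟨⟨k', hk', h1⟩, k, hk, h2⟩ := hn
      exact absurd (hcross k hk k' hk' h2) (not_le.2 h1)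
    rw [setIntegral_posPart_of_nonneg hσ h _ hside]
    refine ⟨mul_le_mul_of_nonneg_left hle hA.le, ?_⟩
    rw [mul_right_inj' hA.ne', Finset.sum_eq_sum_iff_of_le fun k _ => by
      rw [diagonalWeight]
      split_ifs <;> simp]
    have hgood : (∀ k ∈ σ, max 0 (bracket (p i) (p j) (p k)) = diagonalWeight p i j k) ↔
        ∀ k ∈ σ, k = i ∨ k = j ∨ bracket (p i) (p j) (p k) ≠ 0 := by
      refine forall₂_congr fun k _ => ?_
      rw [diagonalWeight]
      split_ifs with hc
      · simp [hc]
      · simp only [add_zero, true_iff]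
        tauto
    rw [hgood]
    constructor
    · intro h1
      rcases hside with hs | hs
      · exact Or.inl fun k hk => (h1 k hk).imp_right
          (Or.imp_right fun hne => lt_of_le_of_ne (hs k hk) hne.symm)
      · exact Or.inr fun k hk => (h1 k hk).imp_right
          (Or.imp_right fun hne => lt_of_le_of_ne (hs k hk) hne)
    · rintro (h1 | h1)
      · exact fun k hk => (h1 k hk).imp_right (Or.imp_right fun h => h.ne')
      · exact fun k hk => (h1 k hk).imp_right (Or.imp_right fun h => h.ne)

lemma IsTriangulation.diagonalBound_le [Fintype ι] (hT : IsTriangulation p T) (i j : ι) :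
    diagonalBound p i j ≤ ∑ k, diagonalWeight p i j k * gkzCoeff p T k := by
  rw [sum_mul_gkzCoeff p T, diagonalBound, hT.setIntegral_eq_sum (continuous_max_zero_affineMap _),
    Finset.mul_sum]
  exact Finset.sum_le_sum fun σ hσ =>
    (diagonalWeight_triangle (hT.card_eq σ hσ) (hT.affineIndependent σ hσ) i j).1

lemma IsTriangulation.diagonalBound_eq_iff [Fintype ι] (hT : IsTriangulation p T) (i j : ι) :
    ∑ k, diagonalWeight p i j k * gkzCoeff p T k = diagonalBound p i j ↔
      ∀ σ ∈ T, LiesOnOneSide p i j σ := by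
  rw [eq_comm, sum_mul_gkzCoeff p T, diagonalBound,
    hT.setIntegral_eq_sum (continuous_max_zero_affineMap _), Finset.mul_sum,
    Finset.sum_eq_sum_iff_of_le fun σ hσ =>
      (diagonalWeight_triangle (hT.card_eq σ hσ) (hT.affineIndependent σ hσ) i j).1]
  exact forall₂_congr fun σ hσ =>
    (diagonalWeight_triangle (hT.card_eq σ hσ) (hT.affineIndependent σ hσ) i j).2

end Triangulation

/-! ### Configurations in cyclic position and the triangulations of maximal dissections -/

/-- The points `q 0, …, q (m - 1)` lie in this counterclockwise order on the boundary of a convex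
polygon, and three of them are collinear only if they are consecutive, the middle one lying between
the other two. -/
structure IsCyclicPosition {m : ℕ} (q : Fin m → Plane) : Prop where
  injective : Function.Injective q
  nonneg : ∀ a b c : Fin m, (a : ℕ) < b → (b : ℕ) < c → 0 ≤ bracket (q a) (q b) (q c)
  zero : ∀ a b c : Fin m, (a : ℕ) < b → (b : ℕ) < c → bracket (q a) (q b) (q c) = 0 →
    ((b : ℕ) = a + 1 ∧ (c : ℕ) = b + 1 ∧ q b ∈ openSegment ℝ (q a) (q c)) ∨
    ((a : ℕ) = 0 ∧ (c : ℕ) + 1 = m ∧ (c : ℕ) = b + 1 ∧ q c ∈ openSegment ℝ (q b) (q a)) ∨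
    ((a : ℕ) = 0 ∧ (c : ℕ) + 1 = m ∧ (b : ℕ) = a + 1 ∧ q a ∈ openSegment ℝ (q c) (q b))
  exists_ne_zero : ∃ a b c : Fin m, (a : ℕ) < b ∧ (b : ℕ) < c ∧ bracket (q a) (q b) (q c) ≠ 0

/-- Extending weights by zero to all labels makes representations over different label sets
comparable. -/
lemma mem_hullOf_iff_of_fintype {ι : Type*} [Fintype ι] {p : ι → Plane} {σ : Finset ι} {x : Plane} :
    x ∈ hullOf p σ ↔ ∃ w : ι → ℝ, (∀ i, 0 ≤ w i) ∧ (∀ i ∉ σ, w i = 0) ∧ ∑ i, w i = 1 ∧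
      ∑ i, w i • p i = x := by
  classical
  rw [mem_hullOf]
  constructor
  · rintro ⟨w, hw, hw1, hwx⟩
    refine ⟨fun i => if i ∈ σ then w i else 0, fun i => ?_, fun i hi => by simp [hi], ?_, ?_⟩
    · dsimp only
      split_ifs with h
      · exact hw i h
      · exact le_rfl
    · simpa [Finset.sum_ite_mem] using hw1
    · simpa [ite_smul, Finset.sum_ite_mem] using hwx
  · rintro ⟨w, hw, hw0, hw1, hwx⟩
    refine ⟨w, fun i _ => hw i, ?_, ?_⟩
    · rw [← hw1]
      exact Finset.sum_subset (Finset.subset_univ _) fun i _ hi => hw0 i hi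
    · rw [← hwx]
      exact Finset.sum_subset (Finset.subset_univ _) fun i _ hi => by rw [hw0 i hi, zero_smul]

/-! ### Hulls lying on one side of a line -/

section Sides

variable {ι : Type*} [Fintype ι] {p : ι → Plane} {σ τ : Finset ι}

/-- A point of a line that lies in the convex hull of points on one side of the line only involves
those of them on the line. -/
lemma eq_or_eq_of_weight_ne_zero {l : Plane →ᵃ[ℝ] ℝ} {i j : ι} (hi : l (p i) = 0)
    (hj : l (p j) = 0) (h : ∀ k ∈ σ, k = i ∨ k = j ∨ 0 < l (p k)) {w : ι → ℝ}
    (hw : ∀ k, 0 ≤ w k) (hw0 : ∀ k ∉ σ, w k = 0) (hw1 : ∑ k, w k = 1)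
    (hx : l (∑ k, w k • p k) ≤ 0) {k : ι} (hk : w k ≠ 0) : k = i ∨ k = j := by
  have hkσ : k ∈ σ := by
    by_contra hn
    exact hk (hw0 k hn)
  rw [affineMap_sum l hw1] at hx
  simp only [smul_eq_mul] at hx
  have hterm : ∀ s ∈ Finset.univ, 0 ≤ w s * l (p s) := by
    intro s _
    by_cases hs : s ∈ σ
    · rcases h s hs with rfl | rfl | h
      · simp [hi]
      · simp [hj]
      · exact mul_nonneg (hw s) h.le
    · simp [hw0 s hs]
  have h0 := (Finset.sum_eq_zero_iff_of_nonneg hterm).1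
    (le_antisymm hx (Finset.sum_nonneg hterm)) k (Finset.mem_univ k)
  rcases h k hkσ with h | h | h
  · exact Or.inl h
  · exact Or.inr h
  · exact absurd h0 (mul_pos (lt_of_le_of_ne (hw k) hk.symm) h).ne'

lemma LiesOnOneSide.eq_or_eq {i j : ι} (h : LiesOnOneSide p i j σ) {w : ι → ℝ}
    (hw : ∀ k, 0 ≤ w k) (hw0 : ∀ k ∉ σ, w k = 0) (hw1 : ∑ k, w k = 1)
    (hx : bracket (p i) (p j) (∑ k, w k • p k) = 0) {k : ι} (hk : w k ≠ 0) : k = i ∨ k = j := by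
  rcases h with h | h
  · exact eq_or_eq_of_weight_ne_zero (by simp) (by simp) h hw hw0 hw1 hx.le hk
  · exact eq_or_eq_of_weight_ne_zero (p := p) (l := -bracket (p i) (p j)) (by simp) (by simp)
      (by simpa using h) hw hw0 hw1 (by simp [hx]) hk

variable [DecidableEq ι]

/-- A common point lies on the separating line, so each of its two representations involves only `p
i` and `p j`. As these points differ, the weights agree and are supported on `σ ∩ τ`. -/
lemma hullOf_inter_subset_of_separated {i j : ι} (hij : p i ≠ p j)
    (hσ : ∀ k ∈ σ, k = i ∨ k = j ∨ bracket (p i) (p j) (p k) < 0)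
    (hτ : ∀ k ∈ τ, k = i ∨ k = j ∨ 0 < bracket (p i) (p j) (p k)) :
    hullOf p σ ∩ hullOf p τ ⊆ hullOf p (σ ∩ τ) := by
  rintro x ⟨hxσ, hxτ⟩
  have hne : i ≠ j := fun h => hij (by rw [h])
  have hle : 0 ≤ -bracket (p i) (p j) x :=
    affineMap_nonneg_of_mem_hullOf (l := -bracket (p i) (p j)) (fun k hk => by
      rcases hσ k hk with rfl | rfl | h
      · simp
      · simp
      · exact (neg_pos.2 h).le) hxσ
  have hge : 0 ≤ bracket (p i) (p j) x := affineMap_nonneg_of_mem_hullOf (fun k hk => by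
      rcases hτ k hk with rfl | rfl | h
      · simp
      · simp
      · exact h.le) hxτ
  have h0 : bracket (p i) (p j) x = 0 := by linarith
  obtain ⟨w, hw, hw0, hw1, rfl⟩ := mem_hullOf_iff_of_fintype.1 hxσ
  obtain ⟨v, hv, hv0, hv1, hvx⟩ := mem_hullOf_iff_of_fintype.1 hxτ
  have hw2 : ∀ k, k ≠ i ∧ k ≠ j → w k = 0 := fun k hk => by
    by_contra hn
    have := LiesOnOneSide.eq_or_eq (Or.inr hσ) hw hw0 hw1 h0 hn
    tauto
  have hv2 : ∀ k, k ≠ i ∧ k ≠ j → v k = 0 := fun k hk => by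
    by_contra hn
    have := LiesOnOneSide.eq_or_eq (Or.inl hτ) hv hv0 hv1 (by rw [hvx]; exact h0) hn
    tauto
  have e1 := Fintype.sum_eq_add (f := w) i j hne hw2
  have e2 := Fintype.sum_eq_add (f := v) i j hne hv2
  have e3 := Fintype.sum_eq_add (f := fun k => w k • p k) i j hne
    fun k hk => by rw [hw2 k hk, zero_smul]
  have e4 := Fintype.sum_eq_add (f := fun k => v k • p k) i j hne
    fun k hk => by rw [hv2 k hk, zero_smul]
  rw [hw1] at e1
  rw [hv1] at e2
  have hwi : w i = v i := by
    have h1 : (w i - v i) • (p i - p j) = 0 := by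
      have h2 : w i • p i + w j • p j = v i • p i + v j • p j := by rw [← e3, ← e4, hvx]
      have h3 : w j = 1 - w i := by linarith
      have h4 : v j = 1 - v i := by linarith
      rw [h3, h4] at h2
      have h5 := sub_eq_zero.2 h2
      rw [← h5]
      module
    rcases smul_eq_zero.1 h1 with h | h
    · linarith
    · exact absurd (sub_eq_zero.1 h) hij
  have hwv : ∀ k, w k = v k := by
    intro k
    by_cases hki : k = i
    · rw [hki, hwi]
    · by_cases hkj : k = j
      · rw [hkj]; linarith
      · rw [hw2 k ⟨hki, hkj⟩, hv2 k ⟨hki, hkj⟩]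
  refine mem_hullOf_iff_of_fintype.2 ⟨w, hw, fun k hk => ?_, hw1, rfl⟩
  by_cases hkσ : k ∈ σ
  · rw [hwv]
    exact hv0 k fun h => hk (Finset.mem_inter.2 ⟨hkσ, h⟩)
  · exact hw0 k hkσ

end Sides

/-! ### Diagonals and triangles of points in cyclic position -/

section Cyclic

variable {m : ℕ} {q : Fin m → Plane}

lemma IsCyclicPosition.three_le (hq : IsCyclicPosition q) : 3 ≤ m := by
  obtain ⟨a, b, c, h1, h2, -⟩ := hq.exists_ne_zero
  have := c.2
  omega

/-- The sum is twice the area of the quadrilateral `a b c d`. If it vanished, two triples would be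
collinear; the index conditions in `zero` then force these to be all the points, with `m = 4`, and
every triple is collinear. Positivity makes the intersection of the two diagonals computable. -/
lemma IsCyclicPosition.bracket_add_pos (hq : IsCyclicPosition q) {a b c d : Fin m}
    (hab : (a : ℕ) < b) (hbc : (b : ℕ) < c) (hcd : (c : ℕ) < d) :
    0 < bracket (q a) (q b) (q d) + bracket (q b) (q c) (q d) := by
  have h1 := hq.nonneg a b d hab (hbc.trans hcd)
  have h2 := hq.nonneg b c d hbc hcd
  by_contra hn
  have e1 : bracket (q a) (q b) (q d) = 0 := by linarith
  have e2 : bracket (q b) (q c) (q d) = 0 := by linarith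
  have i1 := hq.zero a b d hab (hbc.trans hcd) e1
  have i2 := hq.zero b c d hbc hcd e2
  have key : (a : ℕ) = 0 ∧ (b : ℕ) = 1 ∧ (c : ℕ) = 2 ∧ (d : ℕ) = 3 ∧ m = 4 := by
    rcases i1 with ⟨h, h', -⟩ | ⟨h, h', h'', -⟩ | ⟨h, h', h'', -⟩ <;>
      rcases i2 with ⟨g, g', -⟩ | ⟨g, g', g'', -⟩ | ⟨g, g', g'', -⟩ <;> omega
  obtain ⟨ha, hb, hc, hd, hm⟩ := key
  have h3 := hq.nonneg a b c hab hbc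
  have h4 := hq.nonneg a c d (hab.trans hbc) hcd
  have hsum : bracket (q a) (q b) (q c) + bracket (q a) (q c) (q d) =
      bracket (q a) (q b) (q d) + bracket (q b) (q c) (q d) := by
    simp only [bracket_apply]; ring
  obtain ⟨x, y, z, hxy, hyz, hne⟩ := hq.exists_ne_zero
  apply hne
  have hz := z.2
  have hcases : (x = a ∧ y = b ∧ z = c) ∨ (x = a ∧ y = b ∧ z = d) ∨ (x = a ∧ y = c ∧ z = d) ∨
      (x = b ∧ y = c ∧ z = d) := by
    simp only [Fin.ext_iff]
    omega
  rcases hcases with ⟨rfl, rfl, rfl⟩ | ⟨rfl, rfl, rfl⟩ | ⟨rfl, rfl, rfl⟩ | ⟨rfl, rfl, rfl⟩ <;>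
    linarith

/-- Diagonals that are not crossed by any triangle of a triangulation do not cross. -/
lemma IsCyclicPosition.not_lt (hq : IsCyclicPosition q) {T : Finset (Finset (Fin m))}
    (hT : IsTriangulation q T) {a b c d : Fin m} (h1 : ∀ σ ∈ T, LiesOnOneSide q a c σ)
    (h2 : ∀ σ ∈ T, LiesOnOneSide q b d σ) (hab : (a : ℕ) < b) (hbc : (b : ℕ) < c) :
    ¬ (c : ℕ) < d := by
  intro hcd
  have hs := hq.bracket_add_pos hab hbc hcd
  set s := bracket (q a) (q b) (q d) + bracket (q b) (q c) (q d) with hsdef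
  have hs' : s ≠ 0 := hs.ne'
  -- The intersection of the diagonals `a c` and `b d`. In a triangle that neither diagonal crosses,
  -- it could only be a combination of `q a`, `q c` and also only of `q b`, `q d`, which is absurd.
  let x : Plane := (s⁻¹ * bracket (q b) (q c) (q d)) • q a +
    (s⁻¹ * bracket (q a) (q b) (q d)) • q c
  have hxQ : x ∈ convexHull ℝ (Set.range q) := by
    refine convex_convexHull ℝ _ (subset_convexHull ℝ _ (Set.mem_range_self a))
      (subset_convexHull ℝ _ (Set.mem_range_self c))
      (mul_nonneg (inv_nonneg.2 hs.le) (hq.nonneg _ _ _ hbc hcd))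
      (mul_nonneg (inv_nonneg.2 hs.le) (hq.nonneg _ _ _ hab (hbc.trans hcd))) ?_
    rw [← mul_add, add_comm (bracket (q b) (q c) (q d)), ← hsdef, inv_mul_cancel₀ hs']
  have hx1 : bracket (q a) (q c) x = 0 := by
    simp only [x, bracket_apply, PiLp.add_apply, PiLp.smul_apply, smul_eq_mul]
    field_simp
    simp only [hsdef, bracket_apply]
    ring
  have hx2 : bracket (q b) (q d) x = 0 := by
    simp only [x, bracket_apply, PiLp.add_apply, PiLp.smul_apply, smul_eq_mul]
    field_simp
    simp only [hsdef, bracket_apply]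
    ring
  rw [← hT.cover, Set.mem_iUnion₂] at hxQ
  obtain ⟨σ, hσ, hxσ⟩ := hxQ
  obtain ⟨w, hw, hw0, hw1, hwx⟩ := mem_hullOf_iff_of_fintype.1 hxσ
  obtain ⟨k, -, hk⟩ : ∃ k ∈ Finset.univ, w k ≠ 0 := by
    apply Finset.exists_ne_zero_of_sum_ne_zero
    rw [hw1]
    exact one_ne_zero
  have k1 := (h1 σ hσ).eq_or_eq hw hw0 hw1 (by rw [hwx]; exact hx1) hk
  have k2 := (h2 σ hσ).eq_or_eq hw hw0 hw1 (by rw [hwx]; exact hx2) hk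
  simp only [Fin.ext_iff] at k1 k2
  omega

variable {D : Finset (Fin m × Fin m)}

lemma IsArcTriangle.lt {i k j : Fin m} (h : IsArcTriangle D i k j) :
    (i : ℕ) < k ∧ (k : ℕ) < j := ⟨h.1.lt, h.2.1.lt⟩

lemma IsArcTriangle.card {i k j : Fin m} (h : IsArcTriangle D i k j) :
    ({i, k, j} : Finset (Fin m)).card = 3 := by
  have := h.lt
  rw [Finset.card_eq_three]
  exact ⟨i, k, j, by simp only [ne_eq, Fin.ext_iff]; omega, by simp only [ne_eq, Fin.ext_iff]; omega,
    by simp only [ne_eq, Fin.ext_iff]; omega, rfl⟩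

/-- Cyclic position gives the weak inequality. Equality at `s` would make `d.1, s, d.2` consecutive,
leaving no other vertices for the triangle, which would then be degenerate. -/
lemma IsCyclicPosition.bracket_neg_of_inner (hq : IsCyclicPosition q) (hD : IsDissection D)
    {d : Fin m × Fin m} (hd : d ∈ D) {i k j : Fin m} (h : IsArcTriangle D i k j)
    (hne : bracket (q i) (q k) (q j) ≠ 0)
    (hin : ∀ s ∈ ({i, k, j} : Finset (Fin m)), (d.1 : ℕ) ≤ s ∧ (s : ℕ) ≤ d.2) :
    ∀ s ∈ ({i, k, j} : Finset (Fin m)), s = d.1 ∨ s = d.2 ∨ bracket (q d.1) (q d.2) (q s) < 0 := by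
  intro s hs
  by_contra! hn
  obtain ⟨h1, h2, h3⟩ := hn
  have h4 := hin s hs
  have hdiag := hD.1 d hd
  rw [IsDiagonal] at hdiag
  rw [ne_eq, Fin.ext_iff] at h1 h2
  have h5 : (d.1 : ℕ) < s := by omega
  have h6 : (s : ℕ) < d.2 := by omega
  have h7 := hq.nonneg _ _ _ h5 h6
  rw [bracket_swap] at h7
  have h8 : bracket (q d.1) (q s) (q d.2) = 0 := by
    rw [bracket_swap]; linarith
  have h9 : (s : ℕ) = d.1 + 1 ∧ (d.2 : ℕ) = s + 1 := by
    rcases hq.zero _ _ _ h5 h6 h8 with h | h | h <;> omega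
  simp only [Finset.mem_insert, Finset.mem_singleton, forall_eq_or_imp, forall_eq] at hin
  have := h.lt
  have e1 : d.1 = i := Fin.ext (by omega)
  have e2 : s = k := Fin.ext (by omega)
  have e3 : d.2 = j := Fin.ext (by omega)
  rw [e1, e2, e3] at h8
  exact hne h8

/-- As on the inner side: equality would make `s` the only vertex beyond `d`, so the triangle would
be the degenerate one on `s` and the ends of `d`. Here the consecutive triple passes across the
labels `m - 1` and `0`. -/
lemma IsCyclicPosition.bracket_pos_of_outer (hq : IsCyclicPosition q) (hD : IsDissection D)
    {d : Fin m × Fin m} (hd : d ∈ D) {i k j : Fin m} (h : IsArcTriangle D i k j)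
    (hne : bracket (q i) (q k) (q j) ≠ 0)
    (hout : ∀ s ∈ ({i, k, j} : Finset (Fin m)), (s : ℕ) ≤ d.1 ∨ (d.2 : ℕ) ≤ s) :
    ∀ s ∈ ({i, k, j} : Finset (Fin m)), s = d.1 ∨ s = d.2 ∨ 0 < bracket (q d.1) (q d.2) (q s) := by
  intro s hs
  by_contra! hn
  obtain ⟨h1, h2, h3⟩ := hn
  have h4 := hout s hs
  have hdiag := hD.1 d hd
  rw [IsDiagonal] at hdiag
  rw [ne_eq, Fin.ext_iff] at h1 h2
  simp only [Finset.mem_insert, Finset.mem_singleton, forall_eq_or_imp, forall_eq] at hout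
  have hlt := h.lt
  have hjm := j.2
  rcases lt_or_ge (s : ℕ) d.1 with h5 | h5
  · have h7 := hq.nonneg s d.1 d.2 h5 (by omega)
    rw [← bracket_rotate] at h7
    have h8 : bracket (q s) (q d.1) (q d.2) = 0 := by
      rw [← bracket_rotate]; linarith
    have h9 : (s : ℕ) = 0 ∧ (d.1 : ℕ) = 1 ∧ (d.2 : ℕ) + 1 = m := by
      rcases hq.zero s d.1 d.2 h5 (by omega) h8 with h | h | h <;> omega
    have e1 : s = i := Fin.ext (by omega)
    have e2 : d.1 = k := Fin.ext (by omega)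
    have e3 : d.2 = j := Fin.ext (by omega)
    rw [e1, e2, e3] at h8
    exact hne h8
  · have h6 : (d.2 : ℕ) < s := by omega
    have h7 := hq.nonneg d.1 d.2 s (by omega) h6
    have h8 : bracket (q d.1) (q d.2) (q s) = 0 := by linarith
    have h9 : (d.1 : ℕ) = 0 ∧ (s : ℕ) = d.2 + 1 ∧ (s : ℕ) + 1 = m := by
      rcases hq.zero d.1 d.2 s (by omega) h6 h8 with h | h | h <;> omega
    have e1 : d.1 = i := Fin.ext (by omega)
    have e2 : d.2 = k := Fin.ext (by omega)
    have e3 : s = j := Fin.ext (by omega)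
    rw [e1, e2, e3] at h8
    exact hne h8

lemma IsCyclicPosition.liesOnOneSide (hq : IsCyclicPosition q) (hD : IsDissection D)
    {d : Fin m × Fin m} (hd : d ∈ D) {i k j : Fin m} (h : IsArcTriangle D i k j)
    (hne : bracket (q i) (q k) (q j) ≠ 0) : LiesOnOneSide q d.1 d.2 {i, k, j} := by
  have hd' := hD.isArc hd
  have hlt := h.lt
  have hdl := hd'.lt
  have c1 := hD.not_cross hd' h.1
  have c2 := hD.not_cross hd' h.2.1
  have c3 := hD.not_cross hd' h.2.2
  have c4 := hD.not_cross h.1 hd'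
  have c5 := hD.not_cross h.2.1 hd'
  have c6 := hD.not_cross h.2.2 hd'
  by_cases hin : ∀ s ∈ ({i, k, j} : Finset (Fin m)), (d.1 : ℕ) ≤ s ∧ (s : ℕ) ≤ d.2
  · exact Or.inr (hq.bracket_neg_of_inner hD hd h hne hin)
  · refine Or.inl (hq.bracket_pos_of_outer hD hd h hne ?_)
    simp only [Finset.mem_insert, Finset.mem_singleton, forall_eq_or_imp, forall_eq] at hin ⊢
    omega

/-- Two distinct nondegenerate triangles of a dissection meet in a common face. -/
lemma IsCyclicPosition.hullOf_inter_subset (hq : IsCyclicPosition q) (hD : IsDissection D)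
    {i k j i' k' j' : Fin m} (h : IsArcTriangle D i k j) (h' : IsArcTriangle D i' k' j')
    (hne : bracket (q i) (q k) (q j) ≠ 0) (hne' : bracket (q i') (q k') (q j') ≠ 0)
    (hkk : (k : ℕ) < k') :
    hullOf q {i, k, j} ∩ hullOf q {i', k', j'} ⊆ hullOf q ({i, k, j} ∩ {i', k', j'}) := by
  obtain ⟨d, hd, ⟨h1, h2⟩ | ⟨h1, h2⟩⟩ := hD.exists_separating h h' hkk
  all_goals
    have hdne : q d.1 ≠ q d.2 := fun heq => by
      have := (hD.isArc hd).lt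
      rw [hq.injective heq] at this
      exact lt_irrefl _ this
  · exact hullOf_inter_subset_of_separated hdne (hq.bracket_neg_of_inner hD hd h hne h1)
      (hq.bracket_pos_of_outer hD hd h' hne' h2)
  · rw [Set.inter_comm, Finset.inter_comm]
    exact hullOf_inter_subset_of_separated hdne (hq.bracket_neg_of_inner hD hd h' hne' h1)
      (hq.bracket_pos_of_outer hD hd h hne h2)

end Cyclic

/-! ### The triangles of a maximal dissection cover the polygon -/

section Cover

/-- If `x` lies between `a` and `b` and is separated by the line `i k` from `b`, then it lies in
every convex set that contains `i`, `k`, `a`. -/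
lemma mem_of_separated {A : Set Plane} (hA : Convex ℝ A) {i k j a b x : Plane} (hi : i ∈ A)
    (hk : k ∈ A) (ha : a ∈ A) (hx : x ∈ segment ℝ a b) (ε : ℝ) (hΔ : 0 < ε * bracket i k j)
    (hneg : ε * bracket i k x < 0) (hb : 0 ≤ ε * bracket i k b) (hakb : 0 ≤ ε * bracket a k b)
    (hja : 0 ≤ ε * bracket j i a) (hjb : 0 ≤ ε * bracket j i b) : x ∈ A := by
  have hε : ε ≠ 0 := by
    rintro rfl
    simp at hΔ
  rw [segment_eq_image_lineMap] at hx
  obtain ⟨t, ⟨ht0, ht1⟩, rfl⟩ := hx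
  have hline : ∀ (l : Plane →ᵃ[ℝ] ℝ) (t : ℝ), l (AffineMap.lineMap a b t) =
      (1 - t) * l a + t * l b := by
    intro l t
    rw [AffineMap.apply_lineMap, AffineMap.lineMap_apply]
    simp only [vsub_eq_sub, smul_eq_mul, vadd_eq_add]
    ring
  rw [hline] at hneg
  set α := ε * bracket i k a with hα
  set β := ε * bracket i k b with hβ
  have hneg' : (1 - t) * α + t * β < 0 := by
    rw [hα, hβ]; linarith
  have hαneg : α < 0 := by
    by_contra hn
    push Not at hn
    have := mul_nonneg (sub_nonneg.2 ht1) hn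
    have := mul_nonneg ht0 hb
    linarith
  have hden : 0 < β - α := by linarith
  -- The parameter at which the segment from `a` to `b` meets the line `i k`. The meeting point `y`
  -- is shown to lie between `i` and `k`, hence in `A`, and `x` lies between `a` and `y`. The sign
  -- `ε` allows the mirror image of the configuration.
  set u := -α / (β - α) with hu
  have hu0 : 0 ≤ u := div_nonneg (by linarith) hden.le
  have hu1 : u ≤ 1 := by rw [hu, div_le_one hden]; linarith
  have htu : t ≤ u := by
    rw [hu, le_div_iff₀ hden]
    linarith
  set y : Plane := AffineMap.lineMap a b u with hy
  have hy1 : ε * bracket i k y = 0 := by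
    have h1 : ε * ((1 - u) * bracket i k a + u * bracket i k b) = (1 - u) * α + u * β := by
      rw [hα, hβ]; ring
    rw [hy, hline, h1, hu]
    field_simp
    ring
  have hy3 : 0 ≤ ε * bracket j i y := by
    rw [hy, hline, mul_add, mul_left_comm ε, mul_left_comm ε]
    exact add_nonneg (mul_nonneg (sub_nonneg.2 hu1) hja) (mul_nonneg hu0 hjb)
  -- The hypothesis `hakb` keeps `y` on the same side of `k` as `i`.
  have hy2 : 0 ≤ ε * bracket k j y := by
    have hid : ε * bracket k j y * (β - α) = (ε * bracket i k j) * (ε * bracket a k b) := by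
      have h1 : (1 - u) * (β - α) = β := by
        rw [hu]; field_simp; ring
      have h2 : u * (β - α) = -α := by
        rw [hu]; field_simp
      rw [hy, hline]
      calc ε * ((1 - u) * bracket k j a + u * bracket k j b) * (β - α)
          = ε * (((1 - u) * (β - α)) * bracket k j a + (u * (β - α)) * bracket k j b) := by ring
        _ = ε * (β * bracket k j a - α * bracket k j b) := by rw [h1, h2]; ring
        _ = _ := by
          rw [hα, hβ]
          simp only [bracket_apply]
          ring
    have h3 : 0 ≤ ε * bracket k j y * (β - α) := by
      rw [hid]
      exact mul_nonneg hΔ.le hakb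
    exact nonneg_of_mul_nonneg_left h3 hden
  have hΔ' : bracket i k j ≠ 0 := by
    intro h
    rw [h] at hΔ
    simp at hΔ
  have hyA : y ∈ A := by
    have hy1' : bracket i k y = 0 := by simpa [hε] using hy1
    have h1 := baryCoord_smul_add hΔ' y
    have h2 := baryCoord_add hΔ' y
    have h3 : baryCoord j i k y = 0 := by rw [baryCoord_apply, hy1', mul_zero]
    rw [h3, zero_smul, add_zero] at h1
    rw [h3, add_zero] at h2
    have hpos : ∀ z : ℝ, 0 ≤ ε * z → 0 ≤ (bracket i k j)⁻¹ * z := fun z hz => by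
      have : (bracket i k j)⁻¹ * z = (ε * bracket i k j)⁻¹ * (ε * z) := by field_simp
      rw [this]
      exact mul_nonneg (inv_nonneg.2 hΔ.le) hz
    rw [← h1]
    refine hA hi hk ?_ ?_ h2
    · rw [baryCoord_apply]
      exact hpos _ hy2
    · rw [baryCoord_apply, bracket_rotate i k j]
      exact hpos _ hy3
  refine hA.segment_subset ha hyA ?_
  rw [segment_eq_image_lineMap]
  have hupos : 0 < u := div_pos (by linarith) hden
  refine ⟨t / u, ⟨div_nonneg ht0 hu0, (div_le_one hupos).2 htu⟩, ?_⟩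
  rw [hy, AffineMap.lineMap_apply, AffineMap.lineMap_apply, AffineMap.lineMap_apply]
  simp only [vsub_eq_sub, vadd_eq_add, add_sub_cancel_right, smul_smul]
  rw [div_mul_cancel₀ _ hupos.ne']

variable {m : ℕ} {q : Fin m → Plane} {D : Finset (Fin m × Fin m)}

/-- The bracket is affine in each argument, so it suffices to test it on the points `q s` spanning
the two hulls. -/
lemma IsCyclicPosition.bracket_nonneg_of_mem (hq : IsCyclicPosition q) {i k j : Fin m} {a b : Plane}
    (ha : a ∈ hullOf q (Finset.Icc i k)) (hb : b ∈ hullOf q (Finset.Icc k j)) :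
    0 ≤ bracket a (q k) b := by
  have key : ∀ s ∈ Finset.Icc i k, 0 ≤ bracket (q s) (q k) b := by
    intro s hs
    refine affineMap_nonneg_of_mem_hullOf (fun r hr => ?_) hb
    rw [Finset.mem_Icc, Fin.le_def, Fin.le_def] at hs hr
    rcases hs.2.lt_or_eq with h1 | h1
    · rcases hr.1.lt_or_eq with h2 | h2
      · exact hq.nonneg _ _ _ h1 h2
      · rw [← Fin.ext h2]
        simp
    · rw [Fin.ext h1]
      simp [bracket_apply]
  rw [← bracket_rotate]
  refine affineMap_nonneg_of_mem_hullOf (fun s hs => ?_) ha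
  rw [bracket_rotate]
  exact key s hs

lemma Icc_union_Icc_fin {i k j : Fin m} (hik : (i : ℕ) < k) (hkj : (k : ℕ) < j) :
    ((Finset.Icc i j : Finset (Fin m)) : Set (Fin m)) =
      ((Finset.Icc i k : Finset (Fin m)) : Set (Fin m)) ∪ (Finset.Icc k j : Finset (Fin m)) := by
  ext s
  simp only [Finset.coe_Icc, Set.mem_Icc, Set.mem_union, Fin.le_def]
  omega

/-- The part of a polygon cut off by `i j` is covered by the triangle `i k j` and the parts cut off
by `i k` and `k j`. -/
lemma IsCyclicPosition.hullOf_Icc_subset (hq : IsCyclicPosition q) {i k j : Fin m}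
    (hik : (i : ℕ) < k) (hkj : (k : ℕ) < j) :
    hullOf q (Finset.Icc i j) ⊆
      hullOf q (Finset.Icc i k) ∪ hullOf q {i, k, j} ∪ hullOf q (Finset.Icc k j) := by
  intro x hx
  have mi : q i ∈ hullOf q (Finset.Icc i k) :=
    mem_hullOf_of_mem (Finset.left_mem_Icc.2 (Fin.le_def.2 hik.le))
  have mk : q k ∈ hullOf q (Finset.Icc i k) :=
    mem_hullOf_of_mem (Finset.right_mem_Icc.2 (Fin.le_def.2 hik.le))
  have mk' : q k ∈ hullOf q (Finset.Icc k j) :=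
    mem_hullOf_of_mem (Finset.left_mem_Icc.2 (Fin.le_def.2 hkj.le))
  have mj : q j ∈ hullOf q (Finset.Icc k j) :=
    mem_hullOf_of_mem (Finset.right_mem_Icc.2 (Fin.le_def.2 hkj.le))
  rcases (hq.nonneg i k j hik hkj).lt_or_eq with hΔ | hΔ
  · have hx' := hx
    rw [hullOf, Icc_union_Icc_fin hik hkj, Set.image_union,
      convexHull_union (Set.Nonempty.image _ ⟨i, Finset.mem_coe.2
        (Finset.left_mem_Icc.2 (Fin.le_def.2 hik.le))⟩) (Set.Nonempty.image _ ⟨k, Finset.mem_coe.2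
        (Finset.left_mem_Icc.2 (Fin.le_def.2 hkj.le))⟩), mem_convexJoin] at hx'
    obtain ⟨a, ha, b, hb, hab⟩ := hx'
    change a ∈ hullOf q (Finset.Icc i k) at ha
    change b ∈ hullOf q (Finset.Icc k j) at hb
    have hji : ∀ {y}, y ∈ hullOf q (Finset.Icc i j) → 0 ≤ bracket (q j) (q i) y := by
      intro y hy
      refine affineMap_nonneg_of_mem_hullOf (fun s hs => ?_) hy
      rw [Finset.mem_Icc, Fin.le_def, Fin.le_def] at hs
      rcases hs.1.lt_or_eq with h1 | h1
      · rcases hs.2.lt_or_eq with h2 | h2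
        · rw [← bracket_rotate]
          exact hq.nonneg _ _ _ h1 h2
        · rw [Fin.ext h2]
          simp
      · rw [← Fin.ext h1]
        simp
    have ha' := hullOf_mono (p := q) (Finset.Icc_subset_Icc_right (a := i) (Fin.le_def.2 hkj.le)) ha
    have hb' := hullOf_mono (p := q) (Finset.Icc_subset_Icc_left (b := j) (Fin.le_def.2 hik.le)) hb
    have habk := hq.bracket_nonneg_of_mem ha hb
    by_cases h1 : bracket (q i) (q k) x < 0
    · refine Or.inl (Or.inl (mem_of_separated (convex_hullOf _) mi mk ha hab 1 (by simpa using hΔ)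
        (by simpa using h1) ?_ (by simpa using habk) (by simpa using hji ha')
        (by simpa using hji hb')))
      rw [one_mul]
      exact hq.bracket_nonneg_of_mem mi hb
    · by_cases h2 : bracket (q k) (q j) x < 0
      · have e1 := hq.bracket_nonneg_of_mem ha mj
        have e2 := hji hb'
        have e3 := hji ha'
        -- The mirror image of the previous case: `i` and `j` are exchanged, so orientations change
        -- sign.
        refine Or.inr (mem_of_separated (convex_hullOf _) mj mk' hb (j := q i)
          (by rwa [segment_symm]) (-1) ?_ ?_ ?_ ?_ ?_ ?_)
        all_goals
          simp only [bracket_apply] at hΔ h2 e1 e2 e3 habk ⊢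
          linarith
      · refine Or.inl (Or.inr ?_)
        rw [hullOf_three, mem_triangle_iff hΔ.ne']
        push Not at h1 h2
        have hc := hji hx
        refine ⟨?_, ?_, ?_⟩ <;> rw [baryCoord_apply]
        · exact mul_nonneg (inv_nonneg.2 hΔ.le) h2
        · rw [bracket_rotate (q i)]
          exact mul_nonneg (inv_nonneg.2 hΔ.le) hc
        · rw [← bracket_rotate (q j)]
          exact mul_nonneg (inv_nonneg.2 hΔ.le) h1
  -- A degenerate triangle: either `i, k, j` are the only labels in the interval, or one of the end
  -- points `q j`, `q i` is redundant for the hull.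
  · rcases hq.zero i k j hik hkj hΔ.symm with ⟨h1, h2, -⟩ | ⟨h1, h2, h3, h4⟩ | ⟨h1, h2, h3, h4⟩
    · refine Or.inl (Or.inr (hullOf_mono ?_ hx))
      intro s hs
      rw [Finset.mem_Icc, Fin.le_def, Fin.le_def] at hs
      simp only [Finset.mem_insert, Finset.mem_singleton, Fin.ext_iff]
      omega
    · refine Or.inl (Or.inl (convexHull_min ?_ (convex_hullOf _) hx))
      rintro _ ⟨s, hs, rfl⟩
      rw [Finset.coe_Icc, Set.mem_Icc, Fin.le_def, Fin.le_def] at hs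
      by_cases hsj : s = j
      · rw [hsj]
        exact (convex_hullOf _).openSegment_subset mk mi h4
      · rw [Fin.ext_iff] at hsj
        exact mem_hullOf_of_mem (by rw [Finset.mem_Icc, Fin.le_def, Fin.le_def]; omega)
    · refine Or.inr (convexHull_min ?_ (convex_hullOf _) hx)
      rintro _ ⟨s, hs, rfl⟩
      rw [Finset.coe_Icc, Set.mem_Icc, Fin.le_def, Fin.le_def] at hs
      by_cases hsi : s = i
      · rw [hsi]
        exact (convex_hullOf _).openSegment_subset mj mk' h4
      · rw [Fin.ext_iff] at hsi
        exact mem_hullOf_of_mem (by rw [Finset.mem_Icc, Fin.le_def, Fin.le_def]; omega)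

/-- Split below an arc at its apex and recurse on its two lower sides; the recursion stops at arcs
between neighbours, whose hull is spanned by two points. The number `N` bounds the length of the
arc. -/
lemma IsCyclicPosition.exists_mem_of_mem_hullOf_Icc (hq : IsCyclicPosition q)
    (hD : Maximal IsDissection D) {x : Plane} (N : ℕ) : ∀ {i j : Fin m}, (j : ℕ) ≤ i + N →
    IsArc D i j → x ∈ hullOf q (Finset.Icc i j) →
    (∃ σ : Finset (Fin m), σ.card ≤ 2 ∧ x ∈ hullOf q σ) ∨
      ∃ i k j, IsArcTriangle D i k j ∧ x ∈ hullOf q {i, k, j} := by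
  induction N with
  | zero =>
    intro i j hij harc
    have := harc.lt
    omega
  | succ N ih =>
    intro i j hij harc hx
    by_cases hlong : (i : ℕ) + 1 < j
    · obtain ⟨k, hik, hkj, h1, h2⟩ := exists_apex hD harc hlong
      rcases hq.hullOf_Icc_subset hik hkj hx with (h | h) | h
      · exact ih (by omega) h1 h
      · exact Or.inr ⟨i, k, j, ⟨h1, h2, harc⟩, h⟩
      · exact ih (by omega) h2 h
    · refine Or.inl ⟨_, ?_, hx⟩
      rw [Fin.card_Icc]
      omega

open Classical in
/-- The nondegenerate triangles of a dissection. -/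
noncomputable def arcTriangles (q : Fin m → Plane) (D : Finset (Fin m × Fin m)) :
    Finset (Finset (Fin m)) :=
  Finset.univ.filter fun σ =>
    ∃ i k j, IsArcTriangle D i k j ∧ bracket (q i) (q k) (q j) ≠ 0 ∧ σ = {i, k, j}

lemma mem_arcTriangles {σ : Finset (Fin m)} : σ ∈ arcTriangles q D ↔
    ∃ i k j, IsArcTriangle D i k j ∧ bracket (q i) (q k) (q j) ≠ 0 ∧ σ = {i, k, j} := by
  simp [arcTriangles]

lemma IsCyclicPosition.interior_nonempty (hq : IsCyclicPosition q) :
    (interior (convexHull ℝ (Set.range q))).Nonempty := by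
  obtain ⟨a, b, c, -, -, h⟩ := hq.exists_ne_zero
  refine (interior_triangle_nonempty h).mono (interior_mono (convexHull_mono ?_))
  rintro x (rfl | rfl | rfl) <;> exact Set.mem_range_self _

open MeasureTheory in
-- Points outside all hulls of collinear subsets are dense, because those hulls are null sets. Such
-- points of the interior are covered by nondegenerate triangles, and a finite union of triangles is
-- closed.
lemma IsCyclicPosition.subset_iUnion_arcTriangles (hq : IsCyclicPosition q)
    (hD : Maximal IsDissection D) :
    convexHull ℝ (Set.range q) ⊆ ⋃ σ ∈ arcTriangles q D, hullOf q σ := by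
  have hclosed : IsClosed (⋃ σ ∈ arcTriangles q D, hullOf q σ) :=
    Set.Finite.isClosed_biUnion (arcTriangles q D).finite_toSet
      fun σ _ => (isCompact_hullOf σ).isClosed
  have hnull : ∀ᵐ x : Plane, ∀ σ : Finset (Fin m), Collinear ℝ (q '' (σ : Set (Fin m))) →
      x ∉ hullOf q σ := by
    rw [ae_all_iff]
    intro σ
    by_cases hc : Collinear ℝ (q '' (σ : Set (Fin m)))
    · filter_upwards [measure_eq_zero_iff_ae_notMem.1 (volume_hullOf_of_collinear hc)] with x hx _
      exact hx
    · exact ae_of_all _ fun x h => absurd h hc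
  have hdense := Measure.dense_of_ae hnull
  have hm := hq.three_le
  have hIcc : Finset.Icc (⟨0, by omega⟩ : Fin m) ⟨m - 1, by omega⟩ = Finset.univ := by
    ext s
    have := s.2
    simp only [Finset.mem_Icc, Fin.le_def, Finset.mem_univ, iff_true]
    omega
  have hroot : IsArc D (⟨0, by omega⟩ : Fin m) ⟨m - 1, by omega⟩ :=
    ⟨by simp only; omega, Or.inr (Or.inr ⟨rfl, by simp only; omega⟩)⟩
  have hgen : interior (convexHull ℝ (Set.range q)) ∩ {x | ∀ σ : Finset (Fin m),
      Collinear ℝ (q '' (σ : Set (Fin m))) → x ∉ hullOf q σ} ⊆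
        ⋃ σ ∈ arcTriangles q D, hullOf q σ := by
    rintro x ⟨hx, hgx⟩
    have hxI : x ∈ hullOf q (Finset.Icc (⟨0, by omega⟩ : Fin m) ⟨m - 1, by omega⟩) := by
      rw [hIcc, hullOf, Finset.coe_univ, Set.image_univ]
      exact interior_subset hx
    rcases hq.exists_mem_of_mem_hullOf_Icc hD m (by simp) hroot hxI with
      ⟨σ, hσ, hxσ⟩ | ⟨i, k, j, htri, hxσ⟩
    · exact absurd hxσ (hgx σ (collinear_of_card_le_two hσ))
    · refine Set.mem_biUnion (mem_arcTriangles.2 ⟨i, k, j, htri, fun h0 => ?_, rfl⟩) hxσ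
      refine hgx _ ?_ hxσ
      rw [image_insert_three]
      exact (collinear_iff_bracket_eq_zero _ _ _).2 h0
  calc convexHull ℝ (Set.range q) ⊆ closure (convexHull ℝ (Set.range q)) := subset_closure
    _ = closure (interior (convexHull ℝ (Set.range q))) :=
      ((convex_convexHull ℝ _).closure_interior_eq_closure_of_nonempty_interior
        hq.interior_nonempty).symm
    _ ⊆ closure (closure (interior (convexHull ℝ (Set.range q)) ∩ _)) :=
      closure_mono (hdense.open_subset_closure_inter isOpen_interior)
    _ = closure (interior (convexHull ℝ (Set.range q)) ∩ _) := closure_closure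
    _ ⊆ _ := closure_minimal hgen hclosed

/-- The nondegenerate triangles of a maximal dissection form a triangulation. -/
lemma IsCyclicPosition.isTriangulation (hq : IsCyclicPosition q) (hD : Maximal IsDissection D) :
    IsTriangulation q (arcTriangles q D) where
  card_eq σ hσ := by
    obtain ⟨i, k, j, h, -, rfl⟩ := mem_arcTriangles.1 hσ
    exact h.card
  affineIndependent σ hσ := by
    obtain ⟨i, k, j, h, hne, rfl⟩ := mem_arcTriangles.1 hσ
    exact (affineIndependent_iff_bracket_ne_zero h.card).2 hne
  cover := by
    refine subset_antisymm ?_ (hq.subset_iUnion_arcTriangles hD)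
    exact Set.iUnion₂_subset fun σ _ => convexHull_mono (Set.image_subset_range _ _)
  inter σ hσ τ hτ := by
    refine subset_antisymm ?_ (Set.subset_inter (hullOf_mono Finset.inter_subset_left)
      (hullOf_mono Finset.inter_subset_right))
    obtain ⟨i, k, j, h, hne, rfl⟩ := mem_arcTriangles.1 hσ
    obtain ⟨i', k', j', h', hne', rfl⟩ := mem_arcTriangles.1 hτ
    rcases lt_trichotomy (k : ℕ) k' with hk | hk | hk
    · exact hq.hullOf_inter_subset hD.prop h h' hne hne' hk
    · obtain rfl := Fin.ext hk
      obtain ⟨rfl, rfl⟩ := hD.prop.base_unique h.1 h.2.1 h.2.2 h'.1 h'.2.1 h'.2.2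
      simp
    · rw [Set.inter_comm, Finset.inter_comm]
      exact hq.hullOf_inter_subset hD.prop h' h hne' hne hk

/-- A diagonal that cuts no triangle crosses no member of `D`, by `IsCyclicPosition.not_lt`, so
maximality puts it in `D`. -/
lemma IsCyclicPosition.forall_liesOnOneSide_iff (hq : IsCyclicPosition q)
    (hD : Maximal IsDissection D) {d : Fin m × Fin m} (hd : IsDiagonal d) :
    (∀ σ ∈ arcTriangles q D, LiesOnOneSide q d.1 d.2 σ) ↔ d ∈ D := by
  have hmem : ∀ {d}, d ∈ D → ∀ σ ∈ arcTriangles q D, LiesOnOneSide q d.1 d.2 σ := by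
    intro d hd σ hσ
    obtain ⟨i, k, j, h, hne, rfl⟩ := mem_arcTriangles.1 hσ
    exact hq.liesOnOneSide hD.prop hd h hne
  refine ⟨fun h => ?_, hmem⟩
  have hT := hq.isTriangulation hD
  rw [IsDiagonal] at hd
  have hside : ∀ {a b : Fin m}, IsArc D a b → (a, b) ∈ D ∨ (b : ℕ) = a + 1 ∨
      ((a : ℕ) = 0 ∧ (b : ℕ) + 1 = m) := fun h => h.2
  have hd2 := d.2.2
  have := isArc_of_maximal hD (a := d.1) (b := d.2) (by omega)
    (fun a b hab hlt => by
      have hb := b.2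
      rcases hside hab with h' | h' | h'
      · exact hq.not_lt hT h (hmem h') hlt.1 hlt.2.1 hlt.2.2
      · omega
      · omega)
    (fun a b hab hlt => by
      have hb := b.2
      rcases hside hab with h' | h' | h'
      · exact hq.not_lt hT (hmem h') h hlt.1 hlt.2.1 hlt.2.2
      · omega
      · omega)
  exact this.mem hd.1 hd.2

end Cover

/-! ### Sorting the points around the boundary of the polygon -/

lemma not_subset_segment {Q : Set Plane} (hQ : (interior Q).Nonempty) (a b : Plane) :
    ¬ Q ⊆ segment ℝ a b := by
  intro h
  have h0 : MeasureTheory.volume (segment ℝ a b) = 0 := by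
    have h1 := volume_hullOf_of_collinear (p := ![a, b]) (σ := Finset.univ)
      (collinear_of_card_le_two (by simp))
    rwa [hullOf, Finset.coe_univ, Set.image_univ, Matrix.range_cons, Matrix.range_cons,
      Matrix.range_empty, Set.union_empty, Set.singleton_union, convexHull_pair] at h1
  exact (isOpen_interior.measure_pos MeasureTheory.volume hQ).ne'
    (MeasureTheory.measure_mono_null (interior_subset.trans h) h0)

/-- The segment from any `w ∈ Q` to the interior point `y` can be prolonged a little inside `Q`, so
extremality forces `w ∈ B`. -/
lemma IsExtreme.subset_of_mem_interior {Q B : Set Plane} (h : IsExtreme ℝ Q B) {y : Plane}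
    (hyB : y ∈ B) (hy : y ∈ interior Q) : Q ⊆ B := by
  intro w hw
  have hcont : Filter.Tendsto (fun t : ℝ => y + t • (y - w)) (nhdsWithin 0 (Set.Ioi 0))
      (nhds y) := by
    have : Continuous fun t : ℝ => y + t • (y - w) := by fun_prop
    have h2 := (this.tendsto 0).mono_left (nhdsWithin_le_nhds (s := Set.Ioi (0 : ℝ)))
    simpa using h2
  obtain ⟨t, ht1, ht0⟩ := ((hcont.eventually (mem_interior_iff_mem_nhds.1 hy)).and
    self_mem_nhdsWithin).exists
  have ht0' : 0 < t := ht0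
  refine h.left_mem_of_mem_openSegment hw ht1 hyB ?_
  refine ⟨t / (1 + t), 1 / (1 + t), by positivity, by positivity, by field_simp; ring, ?_⟩
  have h1 : (1 + t) ≠ 0 := by positivity
  rw [div_eq_inv_mul, div_eq_inv_mul, mul_smul, mul_smul, ← smul_add, inv_smul_eq_iff₀ h1]
  module

section Sorting

variable {ι : Type*} {Q : Set Plane} {p : ι → Plane}

lemma IsConvexPolygon.isCompact (hQ : IsConvexPolygon Q) : IsCompact Q := by
  obtain ⟨⟨s, hs, rfl⟩, -⟩ := hQ
  exact hs.isCompact_convexHull ℝ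

lemma IsConvexPolygon.convex (hQ : IsConvexPolygon Q) : Convex ℝ Q := by
  obtain ⟨⟨s, hs, rfl⟩, -⟩ := hQ
  exact convex_convexHull ℝ s

lemma IsVerticesAndEdgePoints.mem (hp : IsVerticesAndEdgePoints Q p) (i : ι) : p i ∈ Q := by
  rcases hp.vertex_or_edge i with h | ⟨a, b, h, hi⟩
  · exact h.1
  · exact h.2.subset (openSegment_subset_segment ℝ a b hi)

lemma IsVerticesAndEdgePoints.notMem_interior (hp : IsVerticesAndEdgePoints Q p)
    (hQ : IsConvexPolygon Q) (i : ι) : p i ∉ interior Q := by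
  intro hi
  rcases hp.vertex_or_edge i with h | ⟨a, b, h, hab⟩
  · have := (isExtreme_singleton.2 h).subset_of_mem_interior rfl hi
    rw [← segment_same ℝ (p i)] at this
    exact not_subset_segment hQ.2 _ _ this
  · exact not_subset_segment hQ.2 a b (h.2.isExtreme.subset_of_mem_interior
      (openSegment_subset_segment ℝ a b hab) hi)

lemma IsVerticesAndEdgePoints.convexHull_range [Finite ι] (hp : IsVerticesAndEdgePoints Q p)
    (hQ : IsConvexPolygon Q) : convexHull ℝ (Set.range p) = Q := by
  refine subset_antisymm (convexHull_min (Set.range_subset_iff.2 hp.mem) hQ.convex) ?_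
  rw [← closure_convexHull_extremePoints hQ.isCompact hQ.convex]
  exact closure_minimal (convexHull_mono hp.vertices)
    ((Set.finite_range p).isCompact_convexHull ℝ).isClosed

/-- No further point of the configuration lies on a line through three of them. -/
lemma IsVerticesAndEdgePoints.bracket_ne_zero (hp : IsVerticesAndEdgePoints Q p) {i j k l : ι}
    (hij : i ≠ j) (hjk : j ≠ k) (hik : i ≠ k) (hli : l ≠ i) (hlj : l ≠ j) (hlk : l ≠ k)
    (hmem : p j ∈ openSegment ℝ (p i) (p k)) : bracket (p i) (p k) (p l) ≠ 0 := by
  intro h0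
  rcases hp.vertex_or_edge j with h | ⟨a, b, h, hab⟩
  · exact hij (hp.injective (h.2 (hp.mem i) (hp.mem k) hmem))
  · have hjs : p j ∈ segment ℝ a b := openSegment_subset_segment ℝ a b hab
    have his : p i ∈ segment ℝ a b :=
      h.2.isExtreme.left_mem_of_mem_openSegment (hp.mem i) (hp.mem k) hjs hmem
    have hks : p k ∈ segment ℝ a b :=
      h.2.isExtreme.left_mem_of_mem_openSegment (hp.mem k) (hp.mem i) hjs
        (by rwa [openSegment_symm])
    have hend : ∀ s, s ≠ j → p s ∈ segment ℝ a b → p s = a ∨ p s = b := by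
      intro s hsj hs
      rw [← insert_endpoints_openSegment] at hs
      rcases hs with hs | hs | hs
      · exact Or.inl hs
      · exact Or.inr hs
      · exact absurd (hp.atMostOne a b h s j hs hab) hsj
    -- The functional exposing the edge is constant along the line through `p i` and `p k`, so `p l`
    -- lies on the edge too. Then `p i`, `p k`, `p l` would be three distinct points among its two
    -- ends.
    have hls : p l ∈ segment ℝ a b := by
      obtain ⟨L, hL⟩ := h.2 ⟨p j, hjs⟩
      rw [hL] at his hks ⊢
      refine ⟨hp.mem l, fun y hy => (his.2 y hy).trans ?_⟩
      have heq : L (p k) = L (p i) := le_antisymm (his.2 _ hks.1) (hks.2 _ his.1)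
      have hcol : Collinear ℝ ({p i, p k, p l} : Set Plane) :=
        (collinear_iff_bracket_eq_zero _ _ _).2 h0
      have hline := hcol.mem_affineSpan_of_mem_of_ne (p₁ := p i) (p₂ := p k) (p₃ := p l)
        (by simp) (by simp) (by simp) (hp.injective.ne hik)
      obtain ⟨r, hr⟩ := mem_affineSpan_pair_iff_exists_lineMap_eq.1 hline
      rw [← hr, AffineMap.lineMap_apply, vsub_eq_sub, vadd_eq_add, map_add, map_smul, map_sub, heq]
      simp
    have hne : ∀ {s t}, s ≠ t → p s ≠ p t := fun h => hp.injective.ne h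
    have hl := hend l hlj hls
    have hi := hend i hij his
    have hk := hend k hjk.symm hks
    have h1 := hne hli
    have h2 := hne hlk
    have h3 := hne hik
    rcases hl with hl | hl <;> rcases hi with hi | hi <;> rcases hk with hk | hk <;>
      simp [hl, hi, hk] at h1 h2 h3

/-- Collinearity forced by the two ways of inserting a point next to a midpoint. -/
lemma bracket_eq_zero_of_mem_openSegment {x y z s : Plane} (hy : y ∈ openSegment ℝ x z)
    (h : (0 ≤ bracket x s y ∧ 0 ≤ bracket s y z) ∨ (0 ≤ bracket x y s ∧ 0 ≤ bracket y s z)) :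
    bracket x z s = 0 := by
  obtain ⟨t, u, ht, hu, htu, rfl⟩ := hy
  have e1 : bracket x s (t • x + u • z) = -(u * bracket x z s) := by
    obtain rfl : t = 1 - u := by linarith
    simp only [bracket_apply, PiLp.add_apply, PiLp.smul_apply, smul_eq_mul]; ring
  have e2 : bracket s (t • x + u • z) z = t * bracket x z s := by
    obtain rfl : t = 1 - u := by linarith
    simp only [bracket_apply, PiLp.add_apply, PiLp.smul_apply, smul_eq_mul]; ring
  have e3 : bracket x (t • x + u • z) s = u * bracket x z s := by
    obtain rfl : t = 1 - u := by linarith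
    simp only [bracket_apply, PiLp.add_apply, PiLp.smul_apply, smul_eq_mul]; ring
  have e4 : bracket (t • x + u • z) s z = -(t * bracket x z s) := by
    obtain rfl : t = 1 - u := by linarith
    simp only [bracket_apply, PiLp.add_apply, PiLp.smul_apply, smul_eq_mul]; ring
  rw [e1, e2, e3, e4] at h
  -- In either alternative the two brackets are multiples of `bracket x z s` by factors of opposite
  -- sign.
  have key : 0 ≤ bracket x z s ∧ bracket x z s ≤ 0 := by
    rcases h with ⟨h1, h2⟩ | ⟨h1, h2⟩
    · exact ⟨nonneg_of_mul_nonneg_right h2 ht, by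
        by_contra hn
        push Not at hn
        linarith [mul_pos hu hn]⟩
    · exact ⟨nonneg_of_mul_nonneg_right h1 hu, by
        by_contra hn
        push Not at hn
        linarith [mul_pos ht hn]⟩
  exact le_antisymm key.2 key.1

/-- Points of the configuration whose triples are all positively oriented are in cyclic
position. -/
lemma IsVerticesAndEdgePoints.isCyclicPosition {m : ℕ} {q : Fin m → Plane}
    (hq : IsVerticesAndEdgePoints Q q) (hQ : IsConvexPolygon Q) (hm : 3 ≤ m)
    (hnonneg : ∀ a b c : Fin m, (a : ℕ) < b → (b : ℕ) < c → 0 ≤ bracket (q a) (q b) (q c)) :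
    IsCyclicPosition q where
  injective := hq.injective
  nonneg := hnonneg
  zero a b c hab hbc h0 := by
    have hne : ∀ {s t : Fin m}, (s : ℕ) < t → s ≠ t := fun h h' => by
      rw [h'] at h; exact lt_irrefl _ h
    have hcol := (collinear_iff_bracket_eq_zero _ _ _).2 h0
    have hopen : ∀ {x y z : Fin m}, x ≠ y → y ≠ z → Wbtw ℝ (q x) (q y) (q z) →
        q y ∈ openSegment ℝ (q x) (q z) := by
      intro x y z hxy hyz h
      have h' : q y ∈ segment ℝ (q x) (q z) := h.mem_segment
      rw [← insert_endpoints_openSegment] at h'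
      rcases h' with h' | h' | h'
      · exact absurd (hq.injective h').symm hxy
      · exact absurd (hq.injective h') hyz
      · exact h'
    have rot : ∀ {x y z : Fin m}, 0 ≤ bracket (q x) (q y) (q z) →
        0 ≤ bracket (q y) (q z) (q x) := fun h => by rwa [bracket_rotate]
    have nn := fun {x y z} => hnonneg x y z
    have hcm := c.2
    -- The cases are the three choices of middle point. A label in a cyclic gap next to the middle
    -- one would give a fourth collinear point, which is excluded; so the three labels are
    -- cyclically consecutive.
    rcases hcol.wbtw_or_wbtw_or_wbtw with h | h | h
    · left
      have hmem := hopen (hne hab) (hne hbc) h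
      have key : ∀ s : Fin m, ¬ ((a : ℕ) < s ∧ (s : ℕ) < c ∧ (s : ℕ) ≠ b) := by
        rintro s ⟨h1, h2, h3⟩
        refine hq.bracket_ne_zero (hne hab) (hne hbc) (hne (hab.trans hbc)) (hne h1).symm
          (fun h => h3 (by rw [h])) (hne h2) hmem (bracket_eq_zero_of_mem_openSegment hmem ?_)
        rcases lt_or_gt_of_ne h3 with h3 | h3
        · exact Or.inl ⟨nn h1 h3, nn h3 hbc⟩
        · exact Or.inr ⟨nn hab h3, nn h3 h2⟩
      refine ⟨?_, ?_, hmem⟩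
      · by_contra hn
        exact key ⟨a + 1, by omega⟩ (by simp only; omega)
      · by_contra hn
        exact key ⟨b + 1, by omega⟩ (by simp only; omega)
    · right; left
      have hmem := hopen (hne hbc) (hne (hab.trans hbc)).symm h
      have key : ∀ s : Fin m, ¬ ((s : ℕ) < a ∨ ((b : ℕ) < s ∧ (s : ℕ) ≠ c)) := by
        intro s hs
        have hsa : s ≠ a := fun h => by rw [h] at hs; omega
        have hsb : s ≠ b := fun h => by rw [h] at hs; omega
        have hsc : s ≠ c := fun h => by rw [h] at hs; omega
        refine hq.bracket_ne_zero (hne hbc) (hne (hab.trans hbc)).symm (hne hab).symm hsb hsc hsa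
          hmem (bracket_eq_zero_of_mem_openSegment hmem ?_)
        rcases hs with h1 | ⟨h1, h2⟩
        · exact Or.inr ⟨rot (nn (h1.trans hab) hbc), rot (rot (nn h1 (hab.trans hbc)))⟩
        · rcases lt_or_gt_of_ne h2 with h2 | h2
          · exact Or.inl ⟨nn h1 h2, rot (nn (hab.trans h1) h2)⟩
          · exact Or.inr ⟨nn hbc h2, rot (nn (hab.trans hbc) h2)⟩
      refine ⟨?_, ?_, ?_, hmem⟩
      · by_contra hn
        exact key ⟨0, by omega⟩ (by simp only; omega)
      · by_contra hn
        exact key ⟨c + 1, by omega⟩ (by simp only; omega)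
      · by_contra hn
        exact key ⟨b + 1, by omega⟩ (by simp only; omega)
    · right; right
      have hmem := hopen (hne (hab.trans hbc)).symm (hne hab) h
      have key : ∀ s : Fin m, ¬ ((c : ℕ) < s ∨ ((s : ℕ) < b ∧ (s : ℕ) ≠ a)) := by
        intro s hs
        have hsa : s ≠ a := fun h => by rw [h] at hs; omega
        have hsb : s ≠ b := fun h => by rw [h] at hs; omega
        have hsc : s ≠ c := fun h => by rw [h] at hs; omega
        refine hq.bracket_ne_zero (hne (hab.trans hbc)).symm (hne hab) (hne hbc).symm hsc hsa hsb
          hmem (bracket_eq_zero_of_mem_openSegment hmem ?_)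
        rcases hs with h1 | ⟨h1, h2⟩
        · exact Or.inl ⟨rot (nn (hab.trans hbc) h1), rot (rot (nn hab (hbc.trans h1)))⟩
        · rcases lt_or_gt_of_ne h2 with h2 | h2
          · exact Or.inl ⟨rot (rot (nn h2 (hab.trans hbc))), nn h2 hab⟩
          · exact Or.inr ⟨rot (rot (nn h2 (h1.trans hbc))), nn h2 h1⟩
      refine ⟨?_, ?_, ?_, hmem⟩
      · by_contra hn
        exact key ⟨0, by omega⟩ (by simp only; omega)
      · by_contra hn
        exact key ⟨c + 1, by omega⟩ (by simp only; omega)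
      · by_contra hn
        exact key ⟨a + 1, by omega⟩ (by simp only; omega)
  exists_ne_zero := by
    by_contra! hn
    let x : Fin m := ⟨0, by omega⟩
    let y : Fin m := ⟨1, by omega⟩
    have hxy : x ≠ y := by simp [x, y]
    have hsub : Set.range q ⊆ line[ℝ, q x, q y] := by
      rintro _ ⟨s, rfl⟩
      by_cases h0 : (s : ℕ) = 0
      · rw [show s = x from Fin.ext h0]
        exact left_mem_affineSpan_pair ℝ _ _
      · by_cases h1 : (s : ℕ) = 1
        · rw [show s = y from Fin.ext h1]
          exact right_mem_affineSpan_pair ℝ _ _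
        · have hcol := (collinear_iff_bracket_eq_zero _ _ _).2
            (hn x y s (by simp [x, y]) (by simp only [y]; omega))
          exact hcol.mem_affineSpan_of_mem_of_ne (by simp) (by simp) (by simp)
            (hq.injective.ne hxy)
    have hspan : affineSpan ℝ (Set.range q) = ⊤ := by
      rw [← interior_convexHull_nonempty_iff_affineSpan_eq_top, hq.convexHull_range hQ]
      exact hQ.2
    have htop : line[ℝ, q x, q y] = ⊤ :=
      top_le_iff.1 (hspan ▸ affineSpan_le.2 hsub)
    have h1 := collinear_iff_finrank_le_one.1 (collinear_pair ℝ (q x) (q y))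
    rw [← direction_affineSpan, htop, AffineSubspace.direction_top, finrank_top] at h1
    simp at h1

/-- A point of a convex set in the angle spanned by two others, as seen from an interior point,
lies beyond the chord if it is not interior. -/
lemma bracket_nonneg_of_notMem_interior (hQ : Convex ℝ Q) {c x y z : Plane} (hc : c ∈ interior Q)
    (hx : x ∈ Q) (hz : z ∈ Q) (hy : y ∉ interior Q) (hxy : 0 ≤ bracket c x y)
    (hyz : 0 ≤ bracket c y z) (hxz : 0 < bracket c x z) : 0 ≤ bracket x y z := by
  by_contra hn
  push Not at hn
  apply hy
  have hsum : bracket c x y + bracket c y z - bracket c x z = bracket x y z := by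
    simp only [bracket_apply]; ring
  set X := bracket c x z with hX
  have hX0 := hxz.ne'
  have hb : 0 ≤ (bracket c x y + bracket c y z) / X := div_nonneg (by linarith) hxz.le
  have ha : 0 < -bracket x y z / X := div_pos (by linarith) hxz
  have hab : -bracket x y z / X + (bracket c x y + bracket c y z) / X = 1 := by
    rw [← hsum]; field_simp; ring
  -- If `bracket x y z` is negative, this exhibits `y` as a convex combination with positive weight
  -- at the interior point `c`, so `y` would be interior.
  have hcomb : X • y = (-bracket x y z) • c + (bracket c y z • x + bracket c x y • z) := by
    ext i
    fin_cases i <;> simp [hX, bracket_apply] <;> ring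
  have hy' : y = (-bracket x y z / X) • c + X⁻¹ • (bracket c y z • x + bracket c x y • z) := by
    rw [div_eq_inv_mul, mul_smul, ← smul_add, ← hcomb, smul_smul, inv_mul_cancel₀ hX0, one_smul]
  rw [hy']
  rcases hb.lt_or_eq with hb' | hb'
  · have hS : 0 < bracket c x y + bracket c y z := (div_pos_iff_of_pos_right hxz).1 hb'
    have hw : (bracket c y z / (bracket c x y + bracket c y z)) • x +
        (bracket c x y / (bracket c x y + bracket c y z)) • z ∈ Q :=
      hQ hx hz (div_nonneg hyz hS.le) (div_nonneg hxy hS.le) (by field_simp; ring)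
    have := hQ.combo_interior_self_mem_interior hc hw ha hb hab
    convert this using 2
    rw [smul_add, smul_add, smul_smul, smul_smul, smul_smul, smul_smul]
    congr 2 <;> field_simp
  · have hS : bracket c x y + bracket c y z = 0 := by
      rcases div_eq_zero_iff.1 hb'.symm with h | h
      · exact h
      · exact absurd h hX0
    have h1 : bracket c x y = 0 := by linarith
    have h2 : bracket c y z = 0 := by linarith
    rw [← hb', add_zero] at hab
    rw [h1, h2, hab]
    simpa using hc

end Sorting

/-! ### Angles around an interior point -/

section Angles

variable {Q : Set Plane} {c x y z : Plane}

/-- The vector from `c` to `x` as a complex number. -/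
noncomputable def complexFrom (c x : Plane) : ℂ := ⟨x 0 - c 0, x 1 - c 1⟩

lemma bracket_eq_norm_mul_sin (c x y : Plane) :
    bracket c x y = ‖complexFrom c x‖ * ‖complexFrom c y‖ *
      Real.sin ((complexFrom c y).arg - (complexFrom c x).arg) := by
  have h1 : x 0 - c 0 = _ := (Complex.norm_mul_cos_arg (complexFrom c x)).symm
  have h2 : x 1 - c 1 = _ := (Complex.norm_mul_sin_arg (complexFrom c x)).symm
  have h3 : y 0 - c 0 = _ := (Complex.norm_mul_cos_arg (complexFrom c y)).symm
  have h4 : y 1 - c 1 = _ := (Complex.norm_mul_sin_arg (complexFrom c y)).symm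
  rw [bracket_apply, h1, h2, h3, h4, Real.sin_sub]
  ring

lemma norm_complexFrom_pos (h : x ≠ c) : 0 < ‖complexFrom c x‖ := by
  rw [norm_pos_iff]
  intro h0
  apply h
  have h1 := congrArg Complex.re h0
  have h2 := congrArg Complex.im h0
  simp only [complexFrom, Complex.zero_re, Complex.zero_im] at h1 h2
  ext i
  fin_cases i
  · simp; linarith
  · simp; linarith

lemma ne_of_mem_interior (hc : c ∈ interior Q) (hx' : x ∉ interior Q) : x ≠ c :=
  fun h => hx' (h ▸ hc)

/-- On a common ray from `c`, the nearer point lies on the segment from `c` to the farther one and,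
being different from it, is interior. -/
lemma arg_complexFrom_ne_aux (hQ : Convex ℝ Q) (hc : c ∈ interior Q) (hx' : x ∉ interior Q)
    (hy : y ∈ Q) (hy' : y ∉ interior Q) (hne : x ≠ y)
    (h : (complexFrom c x).arg = (complexFrom c y).arg) :
    ¬ ‖complexFrom c x‖ ≤ ‖complexFrom c y‖ := by
  intro hle
  have hypos := norm_complexFrom_pos (ne_of_mem_interior hc hy')
  set r := ‖complexFrom c x‖ / ‖complexFrom c y‖ with hr
  have hr0 : 0 ≤ r := by positivity
  have hr1 : r ≤ 1 := (div_le_one hypos).2 hle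
  have h1 : x 0 - c 0 = _ := (Complex.norm_mul_cos_arg (complexFrom c x)).symm
  have h2 : x 1 - c 1 = _ := (Complex.norm_mul_sin_arg (complexFrom c x)).symm
  have h3 : y 0 - c 0 = _ := (Complex.norm_mul_cos_arg (complexFrom c y)).symm
  have h4 : y 1 - c 1 = _ := (Complex.norm_mul_sin_arg (complexFrom c y)).symm
  rw [h] at h1 h2
  have hxr : ‖complexFrom c x‖ = r * ‖complexFrom c y‖ := (div_mul_cancel₀ _ hypos.ne').symm
  rw [hxr, mul_assoc] at h1 h2
  rw [← h3] at h1
  rw [← h4] at h2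
  have hx : x = (1 - r) • c + r • y := by
    ext i
    fin_cases i
    · simp; linarith
    · simp; linarith
  rcases hr1.lt_or_eq with hr1 | hr1
  · apply hx'
    rw [hx]
    exact hQ.combo_interior_self_mem_interior hc hy (by linarith) hr0 (by ring)
  · rw [hr1] at hx
    simp at hx
    exact hne hx

lemma arg_complexFrom_ne (hQ : Convex ℝ Q) (hc : c ∈ interior Q) (hx : x ∈ Q)
    (hx' : x ∉ interior Q) (hy : y ∈ Q) (hy' : y ∉ interior Q) (hne : x ≠ y) :
    (complexFrom c x).arg ≠ (complexFrom c y).arg := by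
  intro h
  rcases le_total ‖complexFrom c x‖ ‖complexFrom c y‖ with hle | hle
  · exact arg_complexFrom_ne_aux hQ hc hx' hy hy' hne h hle
  · exact arg_complexFrom_ne_aux hQ hc hy' hx hx' hne.symm h.symm hle

/-- Boundary points of a convex set are in convex position when sorted by angle around an interior
point. -/
lemma bracket_nonneg_of_arg_lt (hQ : Convex ℝ Q) (hc : c ∈ interior Q) (hx : x ∈ Q)
    (hx' : x ∉ interior Q) (hy : y ∈ Q) (hy' : y ∉ interior Q) (hz : z ∈ Q)
    (hz' : z ∉ interior Q) (hxy : (complexFrom c x).arg < (complexFrom c y).arg)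
    (hyz : (complexFrom c y).arg < (complexFrom c z).arg) : 0 ≤ bracket x y z := by
  have nx := norm_complexFrom_pos (ne_of_mem_interior hc hx')
  have ny := norm_complexFrom_pos (ne_of_mem_interior hc hy')
  have nz := norm_complexFrom_pos (ne_of_mem_interior hc hz')
  have bx := Complex.neg_pi_lt_arg (complexFrom c x)
  have bz := Complex.arg_le_pi (complexFrom c z)
  set α := (complexFrom c y).arg - (complexFrom c x).arg with hα
  set β := (complexFrom c z).arg - (complexFrom c y).arg with hβ
  -- The three angles add up to a full turn. If one exceeds `π`, the remaining point lies in the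
  -- smaller angle of the other two and the chord lemma applies; otherwise `bracket x y z` is a sum
  -- of three nonnegative brackets at `c`.
  set γ := 2 * Real.pi - (α + β) with hγ
  have hα0 : 0 < α := by linarith
  have hβ0 : 0 < β := by linarith
  have hγ0 : 0 < γ := by simp only [hγ, hα, hβ]; linarith
  have e1 : bracket c x y = ‖complexFrom c x‖ * ‖complexFrom c y‖ * Real.sin α :=
    bracket_eq_norm_mul_sin c x y
  have e2 : bracket c y z = ‖complexFrom c y‖ * ‖complexFrom c z‖ * Real.sin β :=
    bracket_eq_norm_mul_sin c y z
  have e3 : bracket c z x = ‖complexFrom c z‖ * ‖complexFrom c x‖ * Real.sin γ := by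
    rw [bracket_eq_norm_mul_sin c z x, hγ, Real.sin_two_pi_sub, ← Real.sin_neg]
    congr 2
    simp only [hα, hβ]; ring
  have hneg : ∀ {t : ℝ}, Real.pi < t → t < 2 * Real.pi → Real.sin t < 0 := by
    intro t h1 h2
    have := Real.sin_pos_of_pos_of_lt_pi (x := t - Real.pi) (by linarith) (by linarith)
    rw [Real.sin_sub_pi] at this
    linarith
  by_cases h1 : Real.pi < α
  · have s1 := mul_pos (mul_pos nx ny) (neg_pos.2 (hneg h1 (by linarith)))
    have s2 := mul_pos (mul_pos ny nz)
      (Real.sin_pos_of_pos_of_lt_pi (x := β) hβ0 (by linarith))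
    have s3 := mul_pos (mul_pos nz nx)
      (Real.sin_pos_of_pos_of_lt_pi (x := γ) hγ0 (by linarith))
    rw [mul_neg] at s1
    rw [← bracket_rotate]
    refine bracket_nonneg_of_notMem_interior hQ hc hy hx hz' (by rw [e2]; exact s2.le)
      (by rw [e3]; exact s3.le) ?_
    rw [bracket_swap, e1]
    exact s1
  by_cases h2 : Real.pi < β
  · have s1 := mul_pos (mul_pos ny nz) (neg_pos.2 (hneg h2 (by linarith)))
    have s2 := mul_pos (mul_pos nx ny)
      (Real.sin_pos_of_pos_of_lt_pi (x := α) hα0 (by linarith))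
    have s3 := mul_pos (mul_pos nz nx)
      (Real.sin_pos_of_pos_of_lt_pi (x := γ) hγ0 (by linarith))
    rw [mul_neg] at s1
    rw [bracket_rotate z x y]
    refine bracket_nonneg_of_notMem_interior hQ hc hz hy hx' (by rw [e3]; exact s3.le)
      (by rw [e1]; exact s2.le) ?_
    rw [bracket_swap, e2]
    exact s1
  by_cases h3 : Real.pi < γ
  · have s1 := mul_pos (mul_pos nz nx) (neg_pos.2 (hneg h3 (by linarith)))
    have s2 := mul_pos (mul_pos nx ny)
      (Real.sin_pos_of_pos_of_lt_pi (x := α) hα0 (by linarith))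
    have s3 := mul_pos (mul_pos ny nz)
      (Real.sin_pos_of_pos_of_lt_pi (x := β) hβ0 (by linarith))
    rw [mul_neg] at s1
    refine bracket_nonneg_of_notMem_interior hQ hc hx hz hy' (by rw [e1]; exact s2.le)
      (by rw [e2]; exact s3.le) ?_
    rw [bracket_swap, e3]
    exact s1
  push Not at h1 h2 h3
  have s1 := mul_nonneg (mul_pos nx ny).le (Real.sin_nonneg_of_nonneg_of_le_pi hα0.le h1)
  have s2 := mul_nonneg (mul_pos ny nz).le (Real.sin_nonneg_of_nonneg_of_le_pi hβ0.le h2)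
  have s3 := mul_nonneg (mul_pos nz nx).le (Real.sin_nonneg_of_nonneg_of_le_pi hγ0.le h3)
  rw [← e1] at s1
  rw [← e2] at s2
  rw [← e3] at s3
  have hsum : bracket c x y + bracket c y z + bracket c z x = bracket x y z := by
    simp only [bracket_apply]; ring
  linarith

end Angles

lemma IsVerticesAndEdgePoints.comp_equiv {ι κ : Type*} {Q : Set Plane} {p : ι → Plane}
    (hp : IsVerticesAndEdgePoints Q p) (e : κ ≃ ι) : IsVerticesAndEdgePoints Q (p ∘ e) where
  injective := hp.injective.comp e.injective
  vertices := by
    rw [e.surjective.range_comp]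
    exact hp.vertices
  vertex_or_edge i := hp.vertex_or_edge (e i)
  atMostOne a b h i j hi hj := e.injective (hp.atMostOne a b h (e i) (e j) hi hj)

/-- The points of the configuration can be sorted around the boundary of the polygon. -/
lemma IsVerticesAndEdgePoints.exists_isCyclicPosition {m : ℕ} (hm : 3 ≤ m) {Q : Set Plane}
    {p : Fin m → Plane} (hp : IsVerticesAndEdgePoints Q p) (hQ : IsConvexPolygon Q) :
    ∃ e : Equiv.Perm (Fin m), IsCyclicPosition (p ∘ e) := by
  obtain ⟨c, hc⟩ := hQ.2
  set θ : Fin m → ℝ := fun i => (complexFrom c (p i)).arg with hθ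
  have hinj : Function.Injective θ := fun i j hij => by
    by_contra hne
    exact arg_complexFrom_ne hQ.convex hc (hp.mem i) (hp.notMem_interior hQ i) (hp.mem j)
      (hp.notMem_interior hQ j) (hp.injective.ne hne) hij
  have hmono : StrictMono (θ ∘ Tuple.sort θ) :=
    (Tuple.monotone_sort θ).strictMono_of_injective (hinj.comp (Tuple.sort θ).injective)
  refine ⟨Tuple.sort θ, (hp.comp_equiv _).isCyclicPosition hQ hm fun a b d hab hbd => ?_⟩
  exact bracket_nonneg_of_arg_lt hQ.convex hc (hp.mem _) (hp.notMem_interior hQ _) (hp.mem _)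
    (hp.notMem_interior hQ _) (hp.mem _) (hp.notMem_interior hQ _) (hmono hab) (hmono hbd)

/-! ### Relabelling -/

section Relabel

variable {ι κ : Type*} {p : ι → Plane}

lemma hullOf_map (e : κ ≃ ι) (σ : Finset κ) :
    hullOf p (σ.map e.toEmbedding) = hullOf (p ∘ e) σ := by
  simp [hullOf, Set.image_image]

variable [DecidableEq ι] [DecidableEq κ]

lemma IsTriangulation.map (e : κ ≃ ι) {T : Finset (Finset κ)} (hT : IsTriangulation (p ∘ e) T) :
    IsTriangulation p (T.map (Finset.mapEmbedding e.toEmbedding).toEmbedding) where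
  card_eq σ hσ := by
    obtain ⟨τ, hτ, rfl⟩ := Finset.mem_map.1 hσ
    simpa using hT.card_eq τ hτ
  affineIndependent σ hσ := by
    obtain ⟨τ, hτ, rfl⟩ := Finset.mem_map.1 hσ
    have h1 := hT.card_eq τ hτ
    have h2 := (affineIndependent_iff_not_collinear_image h1).1 (hT.affineIndependent τ hτ)
    refine (affineIndependent_iff_not_collinear_image (by simpa using h1)).2 ?_
    simpa [Set.image_image] using h2
  cover := by
    have h := hT.cover
    rw [e.surjective.range_comp] at h
    rw [← h]
    ext x
    simp only [Set.mem_iUnion, Finset.mem_map, exists_prop, ← hullOf_map]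
    constructor
    · rintro ⟨_, ⟨τ, hτ, rfl⟩, hx⟩
      exact ⟨τ, hτ, hx⟩
    · rintro ⟨τ, hτ, hx⟩
      exact ⟨_, ⟨τ, hτ, rfl⟩, hx⟩
  inter σ hσ τ hτ := by
    obtain ⟨σ', hσ', rfl⟩ := Finset.mem_map.1 hσ
    obtain ⟨τ', hτ', rfl⟩ := Finset.mem_map.1 hτ
    have := hT.inter σ' hσ' τ' hτ'
    simp only [RelEmbedding.coe_toEmbedding, Finset.mapEmbedding_apply, ← Finset.map_inter,
      hullOf_map]
    exact this

lemma gkzVector_map [Fintype ι] [Fintype κ] {E : Type*} [AddCommGroup E] [Module ℝ E] (f : ι → E)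
    (e : κ ≃ ι) (T : Finset (Finset κ)) :
    gkzVector p f (T.map (Finset.mapEmbedding e.toEmbedding).toEmbedding) =
      gkzVector (p ∘ e) (f ∘ e) T := by
  rw [gkzVector, gkzVector, ← e.sum_comp]
  refine Finset.sum_congr rfl fun i _ => ?_
  simp [Finset.filter_map, Function.comp_def, triangleArea, hullOf_map]

lemma secondaryPolytope_comp_equiv_subset [Fintype ι] [Fintype κ] {E : Type*} [AddCommGroup E]
    [Module ℝ E] (p : ι → Plane) (f : ι → E) (e : κ ≃ ι) :
    secondaryPolytope (p ∘ e) (f ∘ e) ⊆ secondaryPolytope p f := by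
  refine convexHull_mono ?_
  rintro _ ⟨T, hT, rfl⟩
  exact ⟨_, hT.map e, (gkzVector_map f e T).symm⟩

lemma secondaryPolytope_comp_equiv [Fintype ι] [Fintype κ] {E : Type*} [AddCommGroup E]
    [Module ℝ E] (p : ι → Plane) (f : ι → E) (e : κ ≃ ι) :
    secondaryPolytope (p ∘ e) (f ∘ e) = secondaryPolytope p f := by
  refine subset_antisymm (secondaryPolytope_comp_equiv_subset p f e) ?_
  have h := secondaryPolytope_comp_equiv_subset (p ∘ e) (f ∘ e) e.symm
  simpa [Function.comp_assoc] using h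

end Relabel

/-! ### Recognizing an associahedron -/

section Recognition

variable {n : ℕ} {E : Type*} [NormedAddCommGroup E] [NormedSpace ℝ E]

lemma exists_maximal_isDissection_ge {m : ℕ} {D : Finset (Fin m × Fin m)} (hD : IsDissection D) :
    ∃ D', D ⊆ D' ∧ Maximal IsDissection D' := Finite.exists_le_maximal hD

lemma isDissection_empty {m : ℕ} : IsDissection (∅ : Finset (Fin m × Fin m)) := by
  simp [IsDissection]

lemma IsDissection.subset {m : ℕ} {D D' : Finset (Fin m × Fin m)} (hD : IsDissection D)
    (h : D' ⊆ D) : IsDissection D' :=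
  ⟨fun d hd => hD.1 d (h hd), fun d hd e he => hD.2 d (h hd) e (h he)⟩

/-- Supporting hyperplanes of a polytope, one for each diagonal of a polygon, and vertices, one for
each maximal dissection, with the incidences and the linear relations of an associahedron. -/
structure AssociahedronData (m : ℕ) (S : Set E) where
  Φ : Fin m × Fin m → E →L[ℝ] ℝ
  c : Fin m × Fin m → ℝ
  v : Finset (Fin m × Fin m) → E
  le_apply : ∀ d, ∀ x ∈ S, c d ≤ Φ d x
  mem : ∀ D, Maximal IsDissection D → v D ∈ S
  apply_eq_iff : ∀ D, Maximal IsDissection D → ∀ d, IsDiagonal d → (Φ d (v D) = c d ↔ d ∈ D)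
  exists_coeff : ∀ D, Maximal IsDissection D → ∀ L : E →L[ℝ] ℝ, ∃ (a : Fin m × Fin m → ℝ) (b : ℝ),
    ∀ x ∈ S, L x = b + ∑ d ∈ D, a d * Φ d x

namespace AssociahedronData

variable {m : ℕ} {S : Set E} (A : AssociahedronData m S)

lemma le_apply_hull (d : Fin m × Fin m) {x : E} (hx : x ∈ convexHull ℝ S) : A.c d ≤ A.Φ d x :=
  convexHull_min (t := {x | A.c d ≤ A.Φ d x}) (fun x hx => A.le_apply d x hx)
    (convex_halfSpace_ge (A.Φ d).isLinear _) hx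

lemma mem_hull {D : Finset (Fin m × Fin m)} (hD : Maximal IsDissection D) :
    A.v D ∈ convexHull ℝ S := subset_convexHull ℝ S (A.mem D hD)

/-- The relation is affine in `x`, so it passes from `S` to the hull; the functionals of `D` thus
act as coordinates there. -/
lemma exists_coeff_hull {D : Finset (Fin m × Fin m)} (hD : Maximal IsDissection D)
    (L : E →L[ℝ] ℝ) : ∃ (a : Fin m × Fin m → ℝ) (b : ℝ),
      ∀ x ∈ convexHull ℝ S, L x = b + ∑ d ∈ D, a d * A.Φ d x := by
  obtain ⟨a, b, h⟩ := A.exists_coeff D hD L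
  refine ⟨a, b, fun x hx => ?_⟩
  have hconv : Convex ℝ {x | (L - ∑ d ∈ D, a d • A.Φ d) x = b} :=
    convex_hyperplane (L - ∑ d ∈ D, a d • A.Φ d).isLinear b
  have hmem : x ∈ {x | (L - ∑ d ∈ D, a d • A.Φ d) x = b} := by
    refine convexHull_min (fun y hy => ?_) hconv hx
    simp [h y hy]
  simp only [Set.mem_ofPred_eq, sub_apply, sum_apply,
    smul_apply, smul_eq_mul] at hmem
  linarith

lemma apply_eq {D : Finset (Fin m × Fin m)} (hD : Maximal IsDissection D) {d : Fin m × Fin m}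
    (hd : d ∈ D) : A.Φ d (A.v D) = A.c d :=
  (A.apply_eq_iff D hD d (hD.prop.1 d hd)).2 hd

/-- The face of the polytope on the supporting hyperplanes of a dissection. -/
def face (D : Finset (Fin m × Fin m)) : Set E :=
  {x ∈ convexHull ℝ S | ∀ d ∈ D, A.Φ d x = A.c d}

lemma v_mem_face {D D' : Finset (Fin m × Fin m)} (hD' : Maximal IsDissection D') (h : D ⊆ D') :
    A.v D' ∈ A.face D :=
  ⟨A.mem_hull hD', fun _ hd => A.apply_eq hD' (h hd)⟩

lemma face_nonempty {D : Finset (Fin m × Fin m)} (hD : IsDissection D) : (A.face D).Nonempty := by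
  obtain ⟨D', h, hD'⟩ := exists_maximal_isDissection_ge hD
  exact ⟨_, A.v_mem_face hD' h⟩

/-- The sum of the functionals of `D` exposes the face: all their lower bounds are attained at once
at the vertex of a maximal dissection containing `D`. -/
lemma isExposed_face {D : Finset (Fin m × Fin m)} (hD : IsDissection D) :
    IsExposed ℝ (convexHull ℝ S) (A.face D) := by
  intro _
  obtain ⟨D', h, hD'⟩ := exists_maximal_isDissection_ge hD
  refine ⟨-∑ d ∈ D, A.Φ d, ?_⟩
  ext x
  simp only [face, Set.mem_ofPred_eq, neg_apply, sum_apply,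
    neg_le_neg_iff]
  refine and_congr_right fun hx => ⟨fun h y hy => ?_, fun h' => ?_⟩
  · exact Finset.sum_le_sum fun d hd => (h d hd).le.trans (A.le_apply_hull d hy)
  · have h1 := h' _ (A.mem_hull hD')
    rw [Finset.sum_congr rfl fun d hd => A.apply_eq hD' (h hd)] at h1
    have h2 := (Finset.sum_eq_sum_iff_of_le fun d _ => A.le_apply_hull d hx).1
      (le_antisymm (Finset.sum_le_sum fun d _ => A.le_apply_hull d hx) h1)
    exact fun d hd => (h2 d hd).symm

/-- If `e ∈ D'` were not in `D`, inclusion of faces would put `e` in every maximal dissection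
containing `D`; flipping `e` out of one of them is a contradiction. -/
lemma face_subset_face_iff {D D' : Finset (Fin m × Fin m)} (hD : IsDissection D)
    (hD' : IsDissection D') : A.face D ⊆ A.face D' ↔ D' ⊆ D := by
  refine ⟨fun h e he => ?_, fun h x hx => ⟨hx.1, fun d hd => hx.2 d (h hd)⟩⟩
  by_contra hn
  have key : ∀ M, Maximal IsDissection M → D ⊆ M → e ∈ M := fun M hM hDM =>
    (A.apply_eq_iff M hM e (hD'.1 e he)).1 ((h (A.v_mem_face hM hDM)).2 e he)
  obtain ⟨M, hDM, hM⟩ := exists_maximal_isDissection_ge hD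
  obtain ⟨M', hM', hsub, hnot⟩ := exists_flip hM (key M hM hDM)
  exact hnot (key M' hM' fun d hd => hsub (Finset.mem_erase.2
    ⟨fun h => hn (h ▸ hd), hDM hd⟩))

/-- The change of a functional under a flip. -/
lemma flip_apply {D M : Finset (Fin m × Fin m)} (hD : Maximal IsDissection D)
    (hM : Maximal IsDissection M) {d : Fin m × Fin m} (hd : d ∈ D) (hsub : D.erase d ⊆ M)
    (a : Fin m × Fin m → ℝ) :
    ∑ e ∈ D, a e * A.Φ e (A.v M) - ∑ e ∈ D, a e * A.Φ e (A.v D) =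
      a d * (A.Φ d (A.v M) - A.c d) := by
  rw [← Finset.sum_sub_distrib, Finset.sum_eq_single_of_mem d hd]
  · rw [A.apply_eq hD hd]; ring
  · intro e he hne
    rw [A.apply_eq hM (hsub (Finset.mem_erase.2 ⟨hne, he⟩)), A.apply_eq hD he, sub_self]

lemma lt_apply_of_notMem {D : Finset (Fin m × Fin m)} (hD : Maximal IsDissection D)
    {d : Fin m × Fin m} (hd : IsDiagonal d) (h : d ∉ D) : A.c d < A.Φ d (A.v D) :=
  lt_of_le_of_ne (A.le_apply d _ (A.mem D hD)) fun heq => h ((A.apply_eq_iff D hD d hd).1 heq.symm)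

/-- Every nonempty face of the polytope is the face of a dissection. -/
lemma exists_eq_face {F : Set E} (hne : F.Nonempty) (hF : IsExposed ℝ (convexHull ℝ S) F) :
    ∃ D, IsDissection D ∧ A.face D = F := by
  classical
  obtain ⟨l, rfl⟩ := hF hne
  obtain ⟨D₀, -, hD₀⟩ := exists_maximal_isDissection_ge (isDissection_empty (m := m))
  obtain ⟨D, hD, hmax⟩ := Set.exists_max_image {D | Maximal IsDissection D} (fun D => l (A.v D))
    (Set.toFinite _) ⟨D₀, hD₀⟩
  have hD : Maximal IsDissection D := hD
  obtain ⟨a, b, hab⟩ := A.exists_coeff_hull hD l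
  -- Flipping `d` increases the coordinate of `d` and fixes the others, so a positive coefficient
  -- would contradict the choice of `D`.
  have ha : ∀ d ∈ D, a d ≤ 0 := by
    intro d hd
    obtain ⟨M, hM, hsub, hnot⟩ := exists_flip hD hd
    have h1 := A.flip_apply hD hM hd hsub a
    have h2 := hmax M hM
    rw [hab _ (A.mem_hull hM), hab _ (A.mem_hull hD)] at h2
    have h3 := A.lt_apply_of_notMem hM (hD.prop.1 d hd) hnot
    by_contra hn
    push Not at hn
    have := mul_pos hn (sub_pos.2 h3)
    linarith
  have hle : ∀ x ∈ convexHull ℝ S, ∀ d ∈ D, a d * A.Φ d x ≤ a d * A.c d := fun x hx d hd =>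
    mul_le_mul_of_nonpos_left (A.le_apply_hull d hx) (ha d hd)
  have hvD : l (A.v D) = b + ∑ d ∈ D, a d * A.c d := by
    rw [hab _ (A.mem_hull hD)]
    congr 1
    exact Finset.sum_congr rfl fun d hd => by rw [A.apply_eq hD hd]
  -- Each term of `l` is now bounded by its value at `v D`, so `l` is maximal exactly where every
  -- coordinate with nonzero coefficient attains its bound.
  refine ⟨D.filter fun d => a d ≠ 0, hD.prop.subset (Finset.filter_subset _ _), ?_⟩
  ext x
  simp only [face, Set.mem_ofPred_eq, Finset.mem_filter]
  refine and_congr_right fun hx => ⟨fun h y hy => ?_, fun h d hd => ?_⟩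
  · rw [hab x hx, hab y hy]
    refine add_le_add le_rfl (Finset.sum_le_sum fun d hd => ?_)
    by_cases had : a d = 0
    · simp [had]
    · rw [h d ⟨hd, had⟩]
      exact hle y hy d hd
  · have h1 := h _ (A.mem_hull hD)
    rw [hvD, hab x hx] at h1
    have h2 := (Finset.sum_eq_sum_iff_of_le (hle x hx)).1
      (le_antisymm (Finset.sum_le_sum (hle x hx)) (by linarith)) d hd.1
    exact mul_left_cancel₀ hd.2 h2

/-- The functionals of a maximal `D` map the direction space isomorphically onto `D → ℝ`. They are
injective because on directions every functional is a combination of them, and surjective because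
the differences to the flipped vertices give a diagonal system. -/
lemma finrank_vectorSpan {S : Set E} (A : AssociahedronData (n + 3) S) :
    Module.finrank ℝ (vectorSpan ℝ (convexHull ℝ S)) = n := by
  classical
  obtain ⟨D, -, hD⟩ := exists_maximal_isDissection_ge (isDissection_empty (m := n + 3))
  let Ψ : vectorSpan ℝ (convexHull ℝ S) →ₗ[ℝ] D → ℝ :=
    LinearMap.pi fun d => (A.Φ d).toLinearMap.comp (Submodule.subtype _)
  have hΨ : ∀ u d, Ψ u d = A.Φ d u := fun u d => rfl
  have hinj : Function.Injective Ψ := by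
    rw [injective_iff_map_eq_zero]
    intro u hu
    have hu0 : ∀ d ∈ D, A.Φ d u = 0 := fun d hd => congrFun hu ⟨d, hd⟩
    apply Subtype.ext
    refine SeparatingDual.eq_zero_of_forall_dual_eq_zero (R := ℝ) fun L => ?_
    obtain ⟨a, b, hab⟩ := A.exists_coeff_hull hD L
    have hle : vectorSpan ℝ (convexHull ℝ S) ≤
        LinearMap.ker (L - ∑ d ∈ D, a d • A.Φ d).toLinearMap := by
      refine Submodule.span_le.2 ?_
      rintro _ ⟨x, hx, y, hy, rfl⟩
      have h1 := hab x hx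
      have h2 := hab y hy
      simp only [vsub_eq_sub, SetLike.mem_coe, LinearMap.mem_ker, ContinuousLinearMap.coe_coe,
        map_sub, sub_apply, sum_apply,
        smul_apply, smul_eq_mul]
      linarith
    have h3 := hle u.2
    simp only [LinearMap.mem_ker, ContinuousLinearMap.coe_coe, sub_apply,
      sum_apply, smul_apply, smul_eq_mul] at h3
    rw [Finset.sum_eq_zero fun d hd => by rw [hu0 d hd, mul_zero], sub_zero] at h3
    exact h3
  have hsurj : Function.Surjective Ψ := by
    have hflip : ∀ d : D, ∃ u, 0 < Ψ u d ∧ ∀ e, e ≠ d → Ψ u e = 0 := by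
      rintro ⟨d, hd⟩
      obtain ⟨M, hM, hsub, hnot⟩ := exists_flip hD hd
      refine ⟨⟨A.v M - A.v D, vsub_mem_vectorSpan ℝ (A.mem_hull hM) (A.mem_hull hD)⟩, ?_, ?_⟩
      · rw [hΨ, map_sub, A.apply_eq hD hd]
        exact sub_pos.2 (A.lt_apply_of_notMem hM (hD.prop.1 d hd) hnot)
      · rintro ⟨e, he⟩ hne
        have hne' : e ≠ d := fun h => hne (Subtype.ext h)
        rw [hΨ, map_sub, A.apply_eq hD he, A.apply_eq hM (hsub (Finset.mem_erase.2 ⟨hne', he⟩)),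
          sub_self]
    choose u hu1 hu2 using hflip
    intro g
    refine ⟨∑ d, (g d / Ψ (u d) d) • u d, ?_⟩
    ext e
    rw [map_sum, Finset.sum_apply, Finset.sum_eq_single_of_mem e (Finset.mem_univ e)]
    · rw [map_smul, Pi.smul_apply, smul_eq_mul, div_mul_cancel₀ _ (hu1 e).ne']
    · intro d _ hde
      rw [map_smul, Pi.smul_apply, hu2 d e hde.symm, smul_zero]
  rw [(LinearEquiv.ofBijective Ψ ⟨hinj, hsurj⟩).finrank_eq]
  simp [card_of_maximal hD]

theorem isAssociahedron {S : Set E} (hS : S.Finite) (A : AssociahedronData (n + 3) S) :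
    IsAssociahedron n (convexHull ℝ S) where
  polytope := ⟨S, hS, rfl⟩
  dim_eq := A.finrank_vectorSpan
  faces := by
    let φ : (Dissection (n + 3))ᵒᵈ ↪o NonemptyFace (convexHull ℝ S) :=
      OrderEmbedding.ofMapLEIff
        (fun D => ⟨A.face (OrderDual.ofDual D).1, A.face_nonempty (OrderDual.ofDual D).2,
          A.isExposed_face (OrderDual.ofDual D).2⟩)
        (fun D D' => A.face_subset_face_iff (OrderDual.ofDual D).2 (OrderDual.ofDual D').2)
    have hφ : Function.Surjective φ := by
      rintro ⟨F, hne, hF⟩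
      obtain ⟨D, hD, h⟩ := A.exists_eq_face hne hF
      exact ⟨OrderDual.toDual ⟨D, hD⟩, Subtype.ext h⟩
    exact ⟨(RelIso.ofSurjective φ hφ).symm⟩

end AssociahedronData

end Recognition

/-! ### The secondary polytope -/

/-- Only the differences `f i - f i₀` are linearly independent, hence the shift `t`. It is harmless,
because the coefficients of every GKZ vector of a triangulation have the same sum. -/
lemma exists_dual_apply_eq {ι E : Type*} [NormedAddCommGroup E] [NormedSpace ℝ E]
    [FiniteDimensional ℝ E] {f : ι → E} (hf : AffineIndependent ℝ f) (i₀ : ι) (w : ι → ℝ) :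
    ∃ (L : E →L[ℝ] ℝ) (t : ℝ), ∀ i, L (f i) = w i + t := by
  have hli := (affineIndependent_iff_linearIndependent_vsub ℝ f i₀).1 hf
  obtain ⟨L, hL⟩ := LinearMap.exists_extend
    ((Module.Basis.span hli).constr ℝ fun i : {x // x ≠ i₀} => w i - w i₀)
  refine ⟨LinearMap.toContinuousLinearMap L, L (f i₀) - w i₀, fun i => ?_⟩
  rw [LinearMap.coe_toContinuousLinearMap']
  by_cases hi : i = i₀
  · rw [hi]; ring
  · have h1 := LinearMap.congr_fun hL (Module.Basis.span hli ⟨i, hi⟩)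
    have h2 : ((Module.Basis.span hli ⟨i, hi⟩ : _) : E) = f i - f i₀ :=
      congrArg Subtype.val (Module.Basis.span_apply hli ⟨i, hi⟩)
    rw [Module.Basis.constr_basis, LinearMap.comp_apply, Submodule.subtype_apply, h2,
      map_sub] at h1
    linarith

section Secondary

lemma map_gkzVector {ι E F : Type*} [Fintype ι] [DecidableEq ι] [AddCommGroup E] [Module ℝ E]
    [FunLike F E ℝ] [LinearMapClass F ℝ E ℝ] (p : ι → Plane) (f : ι → E)
    (T : Finset (Finset ι)) (L : F) : L (gkzVector p f T) = ∑ i, L (f i) * gkzCoeff p T i := by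
  rw [gkzVector_eq, map_sum]
  exact Finset.sum_congr rfl fun i _ => by rw [map_smul, smul_eq_mul, mul_comm]

/-- The sum of the coefficients of a GKZ vector. -/
noncomputable def gkzTotal {ι : Type*} (p : ι → Plane) : ℝ :=
  3 * ∫ _ in convexHull ℝ (Set.range p), (1 : ℝ)

lemma IsTriangulation.sum_gkzCoeff {ι : Type*} [Fintype ι] [DecidableEq ι] {p : ι → Plane}
    {T : Finset (Finset ι)} (hT : IsTriangulation p T) : ∑ i, gkzCoeff p T i = gkzTotal p := by
  have := hT.sum_affine_mul_gkzCoeff (AffineMap.const ℝ Plane (1 : ℝ))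
  simpa [gkzTotal] using this

/-- Every weight is a combination of affine weights and the weights of the diagonals of a given
maximal dissection. -/
lemma IsCyclicPosition.exists_weight_eq {n : ℕ} {q : Fin (n + 3) → Plane}
    (hq : IsCyclicPosition q) {D : Finset (Fin (n + 3) × Fin (n + 3))}
    (hD : Maximal IsDissection D) (w : Fin (n + 3) → ℝ) :
    ∃ (l : Plane →ᵃ[ℝ] ℝ) (a : Fin (n + 3) × Fin (n + 3) → ℝ),
      ∀ k, w k = l (q k) + ∑ d ∈ D, a d * diagonalWeight q d.1 d.2 k := by
  classical
  obtain ⟨x, y, z, -, -, hxyz⟩ := hq.exists_ne_zero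
  have hyzx : bracket (q y) (q z) (q x) ≠ 0 := by rwa [bracket_rotate]
  have hzxy : bracket (q z) (q x) (q y) ≠ 0 := by rwa [← bracket_rotate]
  let η : Fin 3 → Plane →ᵃ[ℝ] ℝ := ![baryCoord (q x) (q y) (q z), baryCoord (q y) (q z) (q x),
    baryCoord (q z) (q x) (q y)]
  -- Three affine weights and `n` diagonal weights on `n + 3` points: linear independence suffices.
  let b : Fin 3 ⊕ D → Fin (n + 3) → ℝ :=
    Sum.elim (fun j k => η j (q k)) (fun d k => diagonalWeight q d.1.1 d.1.2 k)
  have hli : LinearIndependent ℝ b := by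
    rw [Fintype.linearIndependent_iff]
    intro g hg
    have hg' : ∀ k, ∑ j, g (Sum.inl j) * η j (q k) +
        ∑ d : D, g (Sum.inr d) * diagonalWeight q d.1.1 d.1.2 k = 0 := by
      intro k
      have := congrFun hg k
      simpa [b, Fintype.sum_sum_type] using this
    -- Pair the relation with a GKZ vector; the affine part becomes independent of `T`.
    have hpair : ∀ T, IsTriangulation q T →
        ∑ j, g (Sum.inl j) * (3 * ∫ x in convexHull ℝ (Set.range q), η j x) +
          ∑ d : D, g (Sum.inr d) * ∑ k, diagonalWeight q d.1.1 d.1.2 k * gkzCoeff q T k = 0 := by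
      intro T hT
      have h1 : ∑ k, (∑ j, g (Sum.inl j) * η j (q k) +
        ∑ d : D, g (Sum.inr d) * diagonalWeight q d.1.1 d.1.2 k) * gkzCoeff q T k = 0 :=
        Finset.sum_eq_zero fun k _ => by rw [hg' k, zero_mul]
      simp only [add_mul, Finset.sum_add_distrib, Finset.sum_mul] at h1
      rw [Finset.sum_comm, Finset.sum_comm (γ := Fin (n + 3)) (α := D)] at h1
      simp only [mul_assoc, ← Finset.mul_sum, hT.sum_affine_mul_gkzCoeff] at h1
      exact h1
    -- Compare the triangulations of `D` and of its flip at `d`: only the term of `d` changes, so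
    -- its coefficient vanishes.
    have hr : ∀ d, g (Sum.inr d) = 0 := by
      rintro ⟨d, hd⟩
      obtain ⟨M, hM, hsub, hnot⟩ := exists_flip hD hd
      have hT := hq.isTriangulation hD
      have hT' := hq.isTriangulation hM
      have h1 := hpair _ hT
      have h2 := hpair _ hT'
      have hval : ∀ {e N}, Maximal IsDissection N → e ∈ D →
          (∑ k, diagonalWeight q e.1 e.2 k * gkzCoeff q (arcTriangles q N) k =
            diagonalBound q e.1 e.2 ↔ e ∈ N) := fun {e N} hN he => by
        rw [(hq.isTriangulation hN).diagonalBound_eq_iff,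
          hq.forall_liesOnOneSide_iff hN (hD.prop.1 e he)]
      have h3 : ∑ e : D, g (Sum.inr e) *
          (∑ k, diagonalWeight q e.1.1 e.1.2 k * gkzCoeff q (arcTriangles q M) k -
            diagonalBound q e.1.1 e.1.2) = 0 := by
        have h4 : ∀ e : D, ∑ k, diagonalWeight q e.1.1 e.1.2 k *
            gkzCoeff q (arcTriangles q D) k = diagonalBound q e.1.1 e.1.2 := fun e =>
          (hval hD e.2).2 e.2
        simp only [h4] at h1
        simp only [mul_sub, Finset.sum_sub_distrib]
        linarith
      rw [Fintype.sum_eq_single (⟨d, hd⟩ : D)] at h3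
      · rcases mul_eq_zero.1 h3 with h | h
        · exact h
        · exact absurd ((hval hM hd).1 (sub_eq_zero.1 h)) hnot
      · intro e hne
        have hne' : e.1 ≠ d := fun h => hne (Subtype.ext h)
        rw [(hval hM e.2).2 (hsub (Finset.mem_erase.2 ⟨hne', e.2⟩)), sub_self, mul_zero]
    have hl : ∀ k, ∑ j, g (Sum.inl j) * η j (q k) = 0 := fun k => by
      have := hg' k
      simpa only [hr, zero_mul, Finset.sum_const_zero, add_zero] using this
    have h0 := hl x
    have h1 := hl y
    have h2 := hl z
    simp [η, Fin.sum_univ_three, hxyz, hyzx, hzxy] at h0 h1 h2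
    rintro (j | d)
    · fin_cases j
      · exact h0
      · exact h1
      · exact h2
    · exact hr d
  have hspan := hli.span_eq_top_of_card_eq_finrank' (by
    simp [card_of_maximal hD]; omega)
  have hw : w ∈ Submodule.span ℝ (Set.range b) := by rw [hspan]; exact Submodule.mem_top
  obtain ⟨g, hg⟩ := (Submodule.mem_span_range_iff_exists_fun ℝ).1 hw
  refine ⟨∑ j, g (Sum.inl j) • η j, fun d => if h : d ∈ D then g (Sum.inr ⟨d, h⟩) else 0,
    fun k => ?_⟩
  have h1 := congrFun hg k
  rw [← h1, ← Finset.sum_coe_sort D]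
  simp [b, Fintype.sum_sum_type, Fin.sum_univ_three]

variable {E : Type*} [NormedAddCommGroup E] [NormedSpace ℝ E] [FiniteDimensional ℝ E]

theorem IsCyclicPosition.isAssociahedron {n : ℕ} {q : Fin (n + 3) → Plane}
    (hq : IsCyclicPosition q) {f : Fin (n + 3) → E} (hf : AffineIndependent ℝ f) :
    IsAssociahedron n (secondaryPolytope q f) := by
  classical
  have hfin : {x | ∃ T, IsTriangulation q T ∧ x = gkzVector q f T}.Finite :=
    (Set.finite_range (gkzVector q f)).subset (by
      rintro _ ⟨T, -, rfl⟩
      exact ⟨T, rfl⟩)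
  choose Φ t hΦ using fun d : Fin (n + 3) × Fin (n + 3) =>
    exists_dual_apply_eq hf 0 (diagonalWeight q d.1 d.2)
  have hval : ∀ d T, IsTriangulation q T → Φ d (gkzVector q f T) =
      ∑ k, diagonalWeight q d.1 d.2 k * gkzCoeff q T k + t d * gkzTotal q := by
    intro d T hT
    simp only [map_gkzVector, hΦ, add_mul, Finset.sum_add_distrib, ← Finset.mul_sum,
      hT.sum_gkzCoeff]
  refine AssociahedronData.isAssociahedron hfin
    { Φ := Φ
      c := fun d => diagonalBound q d.1 d.2 + t d * gkzTotal q
      v := fun D => gkzVector q f (arcTriangles q D)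
      le_apply := ?_
      mem := fun D hD => ⟨_, hq.isTriangulation hD, rfl⟩
      apply_eq_iff := ?_
      exists_coeff := ?_ }
  · rintro d _ ⟨T, hT, rfl⟩
    rw [hval d T hT]
    exact add_le_add (hT.diagonalBound_le d.1 d.2) le_rfl
  · intro D hD d hd
    rw [hval d _ (hq.isTriangulation hD), add_left_inj,
      (hq.isTriangulation hD).diagonalBound_eq_iff, hq.forall_liesOnOneSide_iff hD hd]
  · intro D hD L
    obtain ⟨l, a, hw⟩ := hq.exists_weight_eq hD fun i => L (f i)
    refine ⟨a, 3 * (∫ x in convexHull ℝ (Set.range q), l x) -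
      ∑ d ∈ D, a d * (t d * gkzTotal q), ?_⟩
    rintro _ ⟨T, hT, rfl⟩
    have h1 : L (gkzVector q f T) = 3 * (∫ x in convexHull ℝ (Set.range q), l x) +
        ∑ d ∈ D, a d * ∑ k, diagonalWeight q d.1 d.2 k * gkzCoeff q T k := by
      rw [map_gkzVector, ← hT.sum_affine_mul_gkzCoeff l]
      simp only [hw, add_mul, Finset.sum_add_distrib, Finset.sum_mul]
      rw [Finset.sum_comm (γ := Fin (n + 3))]
      simp only [mul_assoc, ← Finset.mul_sum]
    rw [h1]
    simp only [hval _ T hT, mul_add, Finset.sum_add_distrib]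
    ring

end Secondary

theorem mainTheorem2 (n : ℕ) (Q : Set Plane) (hQ : IsConvexPolygon Q)
    (p : Fin (n + 3) → Plane) (hp : IsVerticesAndEdgePoints Q p)
    {E : Type*} [NormedAddCommGroup E] [NormedSpace ℝ E] [FiniteDimensional ℝ E]
    (f : Fin (n + 3) → E) (hf : AffineIndependent ℝ f) :
    IsAssociahedron n (secondaryPolytope p f) := by
  obtain ⟨e, he⟩ := hp.exists_isCyclicPosition (by omega) hQ
  rw [← secondaryPolytope_comp_equiv p f e]
  exact he.isAssociahedron (hf.comp_embedding e.toEmbedding)
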